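/- **Theorem.** For an index $\mathbf k=(k_1,\dots,k_r)$ of positive integers let $$\bar T(k_1,\dots,k_r):=2^r\sum_{0<n_1<\cdots<n_r}\frac{(-1)^{n_r}}{(2n_1-1)^{k_1}(2n_2-2)^{k_2}\cdots(2n_r-r)^{k_r}},$$ where the series is summed in the order of increasing $n_r$, that is, its value is the limit as $N\to\infty$ of the finite sums over $0<n_1<\cdots<n_r\le N$. For positive integers $k\ge r$ let $$W(k,r):=\sum_{\substack{k_1+\cdots+k_r=k\\ k_1,\dots,k_r\ge 1}}\bar T(k_1,\dots,k_r).$$ Let $\bar\zeta(k):=\sum_{n\ge1}(-1)^{n-1}/n^k$ for $k\ge 1$, and for integers $1\le j\le p$ let $Z(p,p):=1$ and, if $j<p$, $$Z(j,p):=\sum_{k=1}^{p-j}(-2)^k\sum_{j=i_0<i_1<\cdots<i_k=p}\ \prod_{l=1}^k\bar\zeta(2i_l-2i_{l-1}).$$ For integers $n\ge1$ and $q\ge 0$ let $$T_n(\{1\}_{2q}):=\sum_{0<n_1\le n_2<n_3\le n_4<\cdots<n_{2q-1}\le n_{2q}<n}\ \prod_{i=1}^{q}\frac{4}{(2n_{2i-1}-1)(2n_{2i})},$$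 so that $T_n(\{1\}_0)=1$ and $T_n(\{1\}_{2q})=0$ for $q\ge 1$ and $n\le q$. Then for all positive integers $m,p$, all the values $\bar T(\mathbf k)$ occurring below and the series $\bar\zeta(2i)$, $i\ge1$, converge, the series on the left-hand side converges, and $$2\sum_{n=1}^{\infty}\frac{T_n(\{1\}_{2m-2})\,T_n(\{1\}_{2p-2})}{2n-1}(-1)^n=(-1)^{m-1}\sum_{j=1}^{p}W(2j+2m-3,\,2m-1)\,Z(j,p).$$ -/

import Mathlib

open Filter Topology

noncomputable section

namespace AltMTV

/-- The set `I(k, r)` of all `(k₁, …, k_r)` of positive integers with `k₁ + ⋯ + k_r = k`. -/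
def indexSet (k r : ℕ) : Finset (Fin r → ℕ) :=
  (Fintype.piFinset fun _ : Fin r => Finset.Icc 1 k).filter fun a => ∑ i, a i = k

/-- The tuples `(n₁, …, n_r)` of integers with `0 < n₁ < ⋯ < n_r ≤ N`. -/
def increasingTuples (r N : ℕ) : Finset (Fin r → ℕ) :=
  (Fintype.piFinset fun _ : Fin r => Finset.Icc 1 N).filter fun a => StrictMono a

/-- The last entry `n_r` of `(n₁, …, n_r)` (with the convention `n₀ = 0` for the empty tuple). -/
def lastEntry {r : ℕ} (a : Fin r → ℕ) : ℕ :=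
  (Fin.cons 0 a : Fin (r + 1) → ℕ) (Fin.last r)

/-- The part `n_r ≤ N` of the series defining `T̄(k₁, …, k_r)`:
`2 ^ r ∑_{0 < n₁ < ⋯ < n_r ≤ N} (-1) ^ n_r / ((2 n₁ - 1) ^ k₁ (2 n₂ - 2) ^ k₂ ⋯ (2 n_r - r) ^ k_r)`.
The position `i : Fin r` stands for the 1-based position `i + 1`. -/
def tbarTrunc {r : ℕ} (k : Fin r → ℕ) (N : ℕ) : ℝ :=
  2 ^ r * ∑ a ∈ increasingTuples r N,
    (-1 : ℝ) ^ lastEntry a / ∏ i : Fin r, (2 * (a i : ℝ) - ((i : ℕ) + 1)) ^ k i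

/-- The alternating multiple `T`-value `T̄(k₁, …, k_r)`. The series need not converge absolutely
(when `k_r = 1`); it is summed by increasing size of the outermost variable `n_r`. -/
def tbar {r : ℕ} (k : Fin r → ℕ) : ℝ :=
  limUnder atTop (tbarTrunc k)

/-- The sum `W(k, r)` of all `T̄(k₁, …, k_r)` of weight `k` and depth `r`. -/
def W (k r : ℕ) : ℝ :=
  ∑ a ∈ indexSet k r, tbar a

/-- Partial sums of `∑_{n ≥ 1} (-1) ^ (n - 1) / n ^ k`. -/
def zetaBarTrunc (k N : ℕ) : ℝ :=
  ∑ n ∈ Finset.Icc 1 N, (-1 : ℝ) ^ (n - 1) / (n : ℝ) ^ k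

/-- The alternating zeta value `ζ̄(k)`, with `ζ̄(0) = 1 / 2`. -/
def zetaBar (k : ℕ) : ℝ :=
  if k = 0 then 1 / 2 else limUnder atTop (zetaBarTrunc k)

/-- The chains `j = i₀ < i₁ < ⋯ < i_k = p`. -/
def chains (j p k : ℕ) : Finset (Fin (k + 1) → ℕ) :=
  (Fintype.piFinset fun _ : Fin (k + 1) => Finset.Icc j p).filter fun i =>
    StrictMono i ∧ i 0 = j ∧ i (Fin.last k) = p

/-- `Z(p, p) = 1`, and for `j < p`
`Z(j, p) = ∑_{k = 1}^{p - j} (-2) ^ k ∑_{j = i₀ < ⋯ < i_k = p} ∏_{l = 1}^k ζ̄(2 i_l - 2 i_{l-1})`. -/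
def Z (j p : ℕ) : ℝ :=
  if j = p then 1 else
    ∑ k ∈ Finset.Icc 1 (p - j), (-2 : ℝ) ^ k *
      ∑ i ∈ chains j p k, ∏ l : Fin k, zetaBar (2 * i l.succ - 2 * i l.castSucc)

/-- The tuples `(n₁, …, n_r)` with `0 < n₁ ≤ n₂ < n₃ ≤ n₄ < ⋯`, where the pattern of `≤` (after an
odd position) and `<` (after an even position) continues up to the comparison of `n_r` with `n`:
`n_r ≤ n` for odd `r`, and `n_r < n` for even `r > 0`. (The 1-based odd positions are the
0-based even ones.) -/
def tTuples (r n : ℕ) : Finset (Fin r → ℕ) :=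
  (Fintype.piFinset fun _ : Fin r => Finset.Icc 1 n).filter fun a =>
    ∀ i : Fin r,
      if Even (i : ℕ) then
        (Fin.snoc a n : Fin (r + 1) → ℕ) i.castSucc ≤ (Fin.snoc a n : Fin (r + 1) → ℕ) i.succ
      else
        (Fin.snoc a n : Fin (r + 1) → ℕ) i.castSucc < (Fin.snoc a n : Fin (r + 1) → ℕ) i.succ

/-- The multiple `T`-harmonic sum `T_n(k₁, …, k_r)`: the variable `n_i` contributes
`(2 n_i - 1) ^ k_i` for odd `i` and `(2 n_i) ^ k_i` for even `i` to the denominator.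
For `r = 0` it is `1`. -/
def tHarm {r : ℕ} (k : Fin r → ℕ) (n : ℕ) : ℝ :=
  ∑ a ∈ tTuples r n, 2 ^ r /
    ∏ i : Fin r, (if Even (i : ℕ) then 2 * (a i : ℝ) - 1 else 2 * (a i : ℝ)) ^ k i

/-- The index `{1}_r = (1, …, 1)` of depth `r`. -/
def ones (r : ℕ) : Fin r → ℕ := fun _ => 1

end AltMTV

end

open Filter Topology

noncomputable section

namespace AltMTV

/-! Write L(t) = log((1 + t)/(1 - t)) and M(k, d) = ∫₀¹ t^k L^d/d! dt (`logMoment`). Integrating the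
derivative of (t^k - t^(k+2)) L^(d+1)/(d+1)! gives a recursion in k that matches the recurrences of
the sums T_n({1}_r). Since M(0, d) = 2 ζ̄(d), with ζ̄(0) = 1/2, it follows (`logMoment_eq_sum`) that
(2n - 1) M(2n - 2, 2j - 2) equals T_n({1}_{2j-2}) plus the terms 2 ζ̄(2j - 2q) T_n({1}_{2q-2}) with
q < j. The numbers Z(j, p) invert this unitriangular system (`eq_sum_Z`), so it remains to evaluate,
for each j, the sum over n of (-1)^n T_n({1}_{2m-2}) M(2n - 2, 2j - 2).

The numbers 2n_i - 1 and 2n_i in T_n form increasing chains of alternating parity, and the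
generating function of T_n({1}_{2a}) is a divided power of 2 arctan t times 1/(1 + t²), up to sign
(`harmSeries_sq`). The sum over n is thereby half of ± ∫₀¹ (2 arctan t)^(2a)/(2a)! · 2/(1 + t²) ·
L^(2b)/(2b)! dt.

The substitution m_i = 2n_i - i turns T̄ into a sum over chains of the same kind, an iterated
integral in the forms 2 du/(1 + u²) and du/u. Under u = (1 - t)/(1 + t) these become -d(2 arctan t)
and -dL. Summing over all indices of fixed weight and depth allows every order of the two forms,
apart from one form at a fixed end, so W collapses to the same one-dimensional integral
(`integral_arctan_pow_mul_logRatio_pow`).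

The series may converge only conditionally. Their terms are (-1)^n/n times sequences of logarithmic
growth and small variation; partial summation gives convergence, and Abel's theorem identifies the
limits. -/

/-! ### Sequences of logarithmic growth -/

/-- `1 + (1 + 1/2 + ⋯ + 1/n)`. -/
def logGauge (n : ℕ) : ℝ := 1 + ∑ i ∈ Finset.range n, 1 / ((i : ℝ) + 1)

lemma one_le_logGauge (n : ℕ) : 1 ≤ logGauge n :=
  le_add_of_nonneg_right (Finset.sum_nonneg fun i _ => by positivity)

lemma logGauge_succ (n : ℕ) : logGauge (n + 1) = logGauge n + 1 / ((n : ℝ) + 1) := by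
  simp [logGauge, Finset.sum_range_succ, add_assoc]

lemma logGauge_mono : Monotone logGauge :=
  monotone_nat_of_le_succ fun n => by
    rw [logGauge_succ]
    have : (0 : ℝ) ≤ 1 / ((n : ℝ) + 1) := by positivity
    linarith

lemma logGauge_pow_mono {k l m n : ℕ} (hkl : k ≤ l) (hmn : m ≤ n) :
    logGauge m ^ k ≤ logGauge n ^ l :=
  (pow_le_pow_left₀ (by linarith [one_le_logGauge m]) (logGauge_mono hmn) k).trans
    (pow_le_pow_right₀ (one_le_logGauge n) hkl)

lemma logGauge_nonneg (n : ℕ) : 0 ≤ logGauge n := by linarith [one_le_logGauge n]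

lemma logGauge_le_succ (n : ℕ) : logGauge n ≤ (n : ℝ) + 1 := by
  induction n with
  | zero => simp [logGauge]
  | succ n ih =>
    rw [logGauge_succ]
    have : 1 / ((n : ℝ) + 1) ≤ 1 := by
      rw [div_le_one (by positivity)]; linarith [Nat.cast_nonneg (α := ℝ) n]
    push_cast; linarith

lemma logGauge_le_log (n : ℕ) : logGauge n ≤ 2 + Real.log ((n : ℝ) + 1) := by
  have h1 := harmonic_le_one_add_log n
  have h2 : logGauge n = 1 + ((harmonic n : ℚ) : ℝ) := by
    simp [logGauge, harmonic]
  rcases Nat.eq_zero_or_pos n with rfl | hn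
  · simp [logGauge]
  · have h3 : Real.log n ≤ Real.log ((n : ℝ) + 1) :=
      Real.log_le_log (by exact_mod_cast hn) (by linarith)
    rw [h2]; linarith

lemma exists_logGauge_pow_le (k : ℕ) :
    ∃ K : ℝ, 0 ≤ K ∧ ∀ n : ℕ, logGauge n ^ k ≤ K * ((n : ℝ) + 1) ^ (1 / 2 : ℝ) := by
  -- In log x ≤ x^ε/ε this choice makes ε k ≤ 1/2; using k + 1 covers k = 0.
  set ε : ℝ := 1 / (2 * ((k : ℝ) + 1)) with hε
  have hε0 : 0 < ε := by positivity
  refine ⟨(2 + 1 / ε) ^ k, by positivity, fun n => ?_⟩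
  have hn : (1 : ℝ) ≤ (n : ℝ) + 1 := by linarith [Nat.cast_nonneg (α := ℝ) n]
  have h1 : logGauge n ≤ (2 + 1 / ε) * ((n : ℝ) + 1) ^ ε := by
    have h2 := Real.log_le_rpow_div (x := (n : ℝ) + 1) (by linarith) hε0
    have h3 := Real.one_le_rpow hn hε0.le
    have h4 := logGauge_le_log n
    rw [add_mul, one_div, inv_mul_eq_div]
    linarith
  calc logGauge n ^ k ≤ ((2 + 1 / ε) * ((n : ℝ) + 1) ^ ε) ^ k :=
        pow_le_pow_left₀ (logGauge_nonneg n) h1 k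
    _ = (2 + 1 / ε) ^ k * ((n : ℝ) + 1) ^ (ε * k) := by
        rw [mul_pow, ← Real.rpow_mul_natCast (by linarith)]
    _ ≤ _ := by
        refine mul_le_mul_of_nonneg_left (Real.rpow_le_rpow_of_exponent_le hn ?_) (by positivity)
        · rw [hε, div_mul_eq_mul_div, one_mul, div_le_div_iff₀ (by positivity) (by positivity)]
          linarith

/-- Sequences bounded by a power of `log n` whose increments are bounded by a power of `log n`
divided by `n`. -/
def SlowlyVarying (u : ℕ → ℝ) : Prop :=
  ∃ (C : ℝ) (k : ℕ), 0 ≤ C ∧ ∀ n : ℕ, |u n| ≤ C * logGauge n ^ k ∧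
    |u (n + 1) - u n| ≤ C * logGauge (n + 1) ^ k / ((n : ℝ) + 1)

namespace SlowlyVarying

variable {u v : ℕ → ℝ}

lemma const (c : ℝ) : SlowlyVarying fun _ => c :=
  ⟨|c|, 0, abs_nonneg c, fun n => ⟨by simp, by simpa using by positivity⟩⟩

lemma add (hu : SlowlyVarying u) (hv : SlowlyVarying v) :
    SlowlyVarying fun n => u n + v n := by
  obtain ⟨C, k, hC, hu⟩ := hu
  obtain ⟨D, l, hD, hv⟩ := hv
  refine ⟨C + D, k + l, by positivity, fun n => ⟨?_, ?_⟩⟩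
  · calc |u n + v n| ≤ |u n| + |v n| := abs_add_le _ _
      _ ≤ C * logGauge n ^ k + D * logGauge n ^ l := add_le_add (hu n).1 (hv n).1
      _ ≤ C * logGauge n ^ (k + l) + D * logGauge n ^ (k + l) :=
        add_le_add
          (mul_le_mul_of_nonneg_left (logGauge_pow_mono (by omega) le_rfl) hC)
          (mul_le_mul_of_nonneg_left (logGauge_pow_mono (by omega) le_rfl) hD)
      _ = _ := by ring
  · calc |u (n + 1) + v (n + 1) - (u n + v n)|
        = |(u (n + 1) - u n) + (v (n + 1) - v n)| := by ring_nf
      _ ≤ |u (n + 1) - u n| + |v (n + 1) - v n| := abs_add_le _ _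
      _ ≤ C * logGauge (n + 1) ^ k / ((n : ℝ) + 1) + D * logGauge (n + 1) ^ l / ((n : ℝ) + 1) :=
        add_le_add (hu n).2 (hv n).2
      _ ≤ C * logGauge (n + 1) ^ (k + l) / ((n : ℝ) + 1)
          + D * logGauge (n + 1) ^ (k + l) / ((n : ℝ) + 1) :=
        add_le_add
          (div_le_div_of_nonneg_right
            (mul_le_mul_of_nonneg_left (logGauge_pow_mono (by omega) le_rfl) hC) (by positivity))
          (div_le_div_of_nonneg_right
            (mul_le_mul_of_nonneg_left (logGauge_pow_mono (by omega) le_rfl) hD) (by positivity))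
      _ = _ := by ring

lemma mul (hu : SlowlyVarying u) (hv : SlowlyVarying v) :
    SlowlyVarying fun n => u n * v n := by
  obtain ⟨C, k, hC, hu⟩ := hu
  obtain ⟨D, l, hD, hv⟩ := hv
  refine ⟨2 * (C * D), k + l, by positivity, fun n => ⟨?_, ?_⟩⟩
  · have hn := logGauge_nonneg n
    calc |u n * v n| = |u n| * |v n| := abs_mul _ _
      _ ≤ (C * logGauge n ^ k) * (D * logGauge n ^ l) :=
        mul_le_mul (hu n).1 (hv n).1 (abs_nonneg _) (by positivity)
      _ = C * D * logGauge n ^ (k + l) := by rw [pow_add]; ring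
      _ ≤ _ := by
        have : 0 ≤ C * D * logGauge n ^ (k + l) := by positivity
        linarith
  · have hn := logGauge_nonneg n
    have hn' := logGauge_nonneg (n + 1)
    calc |u (n + 1) * v (n + 1) - u n * v n|
        = |u (n + 1) * (v (n + 1) - v n) + (u (n + 1) - u n) * v n| := by ring_nf
      _ ≤ |u (n + 1)| * |v (n + 1) - v n| + |u (n + 1) - u n| * |v n| := by
        rw [← abs_mul, ← abs_mul]; exact abs_add_le _ _
      _ ≤ (C * logGauge (n + 1) ^ k) * (D * logGauge (n + 1) ^ l / ((n : ℝ) + 1))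
          + (C * logGauge (n + 1) ^ k / ((n : ℝ) + 1)) * (D * logGauge (n + 1) ^ l) := by
        refine add_le_add
          (mul_le_mul (hu _).1 (hv n).2 (abs_nonneg _) (by positivity))
          (mul_le_mul (hu n).2 ((hv n).1.trans ?_) (abs_nonneg _) (by positivity))
        exact mul_le_mul_of_nonneg_left (logGauge_pow_mono le_rfl (Nat.le_succ n)) hD
      _ = _ := by rw [pow_add]; ring

lemma const_mul (c : ℝ) (hu : SlowlyVarying u) : SlowlyVarying fun n => c * u n :=
  (const c).mul hu

lemma pow (hu : SlowlyVarying u) (k : ℕ) : SlowlyVarying fun n => u n ^ k := by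
  induction k with
  | zero => simpa using const 1
  | succ k ih => simpa only [pow_succ] using ih.mul hu

lemma finset_sum {ι : Type*} (s : Finset ι) {w : ι → ℕ → ℝ}
    (hw : ∀ i ∈ s, SlowlyVarying (w i)) : SlowlyVarying fun n => ∑ i ∈ s, w i n := by
  classical
  induction s using Finset.induction_on with
  | empty => simpa using const 0
  | insert a s ha ih =>
    simp only [Finset.sum_insert ha]
    exact (hw a (by simp)).add (ih fun i hi => hw i (by simp [hi]))

lemma inv_linear {c : ℝ} (hc : 1 ≤ c) : SlowlyVarying fun n => 1 / (c + 2 * (n : ℝ)) := by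
  refine ⟨2, 0, by norm_num, fun n => ?_⟩
  have hn := Nat.cast_nonneg (α := ℝ) n
  have h1 : 0 < c + 2 * (n : ℝ) := by linarith
  have h2 : 0 < c + 2 * ((n : ℝ) + 1) := by linarith
  refine ⟨?_, ?_⟩
  · rw [abs_of_pos (by positivity), pow_zero, div_le_iff₀ h1]; nlinarith
  · push_cast
    rw [abs_sub_comm, abs_of_nonneg]
    · have h4 : 1 / (c + 2 * (n : ℝ)) ≤ 1 / ((n : ℝ) + 1) :=
        one_div_le_one_div_of_le (by positivity) (by linarith)
      have h5 : 0 < 1 / (c + 2 * ((n : ℝ) + 1)) := by positivity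
      have h6 : (2 : ℝ) * logGauge (n + 1) ^ 0 / ((n : ℝ) + 1) = 2 * (1 / ((n : ℝ) + 1)) := by
        rw [pow_zero]; ring
      have h7 : 0 < 1 / ((n : ℝ) + 1) := by positivity
      rw [h6]; linarith
    · exact sub_nonneg.2 (one_div_le_one_div_of_le h1 (by linarith))

/-- Summing against 1/(c + 2i) costs one more power of the logarithm, while the new increments are
the summands themselves. This closure property handles nested harmonic sums by induction on the
depth. -/
lemma partialSum {c : ℝ} (hc : 1 ≤ c) (hu : SlowlyVarying u) :
    SlowlyVarying fun j => ∑ i ∈ Finset.range (j + 1), u i / (c + 2 * (i : ℝ)) := by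
  obtain ⟨C, k, hC, hu⟩ := hu
  have hterm : ∀ i : ℕ, |u i / (c + 2 * (i : ℝ))| ≤ C * logGauge i ^ k / ((i : ℝ) + 1) := by
    intro i
    have hi := Nat.cast_nonneg (α := ℝ) i
    rw [abs_div, abs_of_pos (by linarith : 0 < c + 2 * (i : ℝ))]
    exact div_le_div₀ (by have := logGauge_nonneg i; positivity) (hu i).1 (by positivity)
      (by linarith)
  refine ⟨C, k + 1, hC, fun j => ⟨?_, ?_⟩⟩
  · have hj := logGauge_nonneg j
    calc |∑ i ∈ Finset.range (j + 1), u i / (c + 2 * (i : ℝ))|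
        ≤ ∑ i ∈ Finset.range (j + 1), |u i / (c + 2 * (i : ℝ))| := Finset.abs_sum_le_sum_abs _ _
      _ ≤ ∑ i ∈ Finset.range (j + 1), C * logGauge j ^ k * (1 / ((i : ℝ) + 1)) := by
        refine Finset.sum_le_sum fun i hi => (hterm i).trans ?_
        rw [mul_one_div]
        refine div_le_div_of_nonneg_right (mul_le_mul_of_nonneg_left
          (logGauge_pow_mono le_rfl (by simpa [Nat.lt_succ_iff] using hi)) hC) (by positivity)
      _ = C * logGauge j ^ k * (logGauge (j + 1) - 1) := by
        rw [← Finset.mul_sum, logGauge.eq_1 (j + 1), add_sub_cancel_left]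
      _ ≤ C * logGauge j ^ k * logGauge j := by
        gcongr
        rw [logGauge_succ]
        have : 1 / ((j : ℝ) + 1) ≤ 1 := by
          rw [div_le_one (by positivity)]; linarith [Nat.cast_nonneg (α := ℝ) j]
        linarith
      _ = _ := by ring
  · beta_reduce
    rw [Finset.sum_range_succ _ (j + 1), add_sub_cancel_left]
    refine (hterm (j + 1)).trans ?_
    refine div_le_div₀ (by have := logGauge_nonneg (j + 1); positivity)
      (mul_le_mul_of_nonneg_left (logGauge_pow_mono (by omega) le_rfl) hC) (by positivity) ?_
    push_cast; linarith

lemma exists_le_pow (hu : SlowlyVarying u) :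
    ∃ (C : ℝ) (k : ℕ), ∀ n : ℕ, |u n| ≤ C * ((n : ℝ) + 1) ^ k := by
  obtain ⟨C, k, hC, hu⟩ := hu
  refine ⟨C, k, fun n => (hu n).1.trans (mul_le_mul_of_nonneg_left ?_ hC)⟩
  exact pow_le_pow_left₀ (logGauge_nonneg n) (logGauge_le_succ n) k

end SlowlyVarying

/-- Partial summation expresses the alternating sum through a boundary term and an absolutely
convergent series of increments; bounded variation replaces monotonicity. -/
lemma exists_tendsto_alternating {v : ℕ → ℝ} (h0 : Tendsto v atTop (𝓝 0))
    (hs' : Summable fun n => |v (n + 1) - v n|) :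
    ∃ L : ℝ, Tendsto (fun N => ∑ n ∈ Finset.range N, (-1 : ℝ) ^ n * v n) atTop (𝓝 L) := by
  have hsum : Summable fun n => (-1 : ℝ) ^ n * (v (n + 1) - v n) := by
    refine Summable.of_norm ?_
    simpa using hs'
  have key : ∀ N, ∑ n ∈ Finset.range N, (-1 : ℝ) ^ n * v n
      = (v 0 - (-1) ^ N * v N - ∑ n ∈ Finset.range N, (-1 : ℝ) ^ n * (v (n + 1) - v n)) / 2 := by
    intro N
    induction N with
    | zero => simp
    | succ N ih => rw [Finset.sum_range_succ, ih, Finset.sum_range_succ, pow_succ]; ring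
  have hb : Tendsto (fun N => (-1 : ℝ) ^ N * v N) atTop (𝓝 0) := by
    refine squeeze_zero_norm (a := fun N => |v N|) (fun N => by simp) ?_
    simpa using h0.abs
  exact ⟨_, by simpa only [key] using
    ((tendsto_const_nhds.sub hb).sub hsum.hasSum.tendsto_sum_nat).div_const 2⟩

/-- Powers of the logarithm are O(n^(1/2)), so the terms are O(n^(-1/2)) and their increments
O(n^(-3/2)), which is summable. -/
lemma SlowlyVarying.exists_tendsto {u : ℕ → ℝ} (hu : SlowlyVarying u) {c : ℝ} (hc : 1 ≤ c) :
    ∃ L : ℝ, Tendsto (fun N => ∑ n ∈ Finset.range N, (-1 : ℝ) ^ n * (u n / (c + 2 * (n : ℝ))))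
      atTop (𝓝 L) := by
  obtain ⟨C, k, hC, hu⟩ := hu
  obtain ⟨K, hK, hKn⟩ := exists_logGauge_pow_le k
  have hbound : ∀ n : ℕ, |u n| ≤ C * K * ((n : ℝ) + 1) ^ (1 / 2 : ℝ) := fun n =>
    (hu n).1.trans (by rw [mul_assoc]; exact mul_le_mul_of_nonneg_left (hKn n) hC)
  have hden : ∀ n : ℕ, (n : ℝ) + 1 ≤ c + 2 * (n : ℝ) := fun n => by
    linarith [Nat.cast_nonneg (α := ℝ) n]
  have h0 : Tendsto (fun n : ℕ => u n / (c + 2 * (n : ℝ))) atTop (𝓝 0) := by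
    refine squeeze_zero_norm (a := fun n : ℕ => C * K * ((n : ℝ) + 1) ^ (-(1 / 2) : ℝ)) ?_ ?_
    · intro n
      have hn : (0 : ℝ) < (n : ℝ) + 1 := by positivity
      rw [Real.norm_eq_abs, abs_div, abs_of_pos (hn.trans_le (hden n))]
      calc |u n| / (c + 2 * (n : ℝ)) ≤ (C * K * ((n : ℝ) + 1) ^ (1 / 2 : ℝ)) / ((n : ℝ) + 1) :=
            div_le_div₀ (by positivity) (hbound n) hn (hden n)
        _ = C * K * ((n : ℝ) + 1) ^ (1 / 2 - 1 : ℝ) := by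
            rw [Real.rpow_sub_one hn.ne']; ring
        _ = _ := by norm_num
    · have h1 : Tendsto (fun n : ℕ => (n : ℝ) + 1) atTop atTop :=
        tendsto_atTop_add_const_right _ _ tendsto_natCast_atTop_atTop
      simpa using ((tendsto_rpow_neg_atTop (y := 1 / 2) (by norm_num)).comp h1).const_mul (C * K)
  have hs' : Summable fun n : ℕ => |u (n + 1) / (c + 2 * ((n + 1 : ℕ) : ℝ)) - u n / (c + 2 * n)| := by
    have hsum : Summable fun n : ℕ => (3 * (C * K) * 2) * ((n : ℝ) + 1) ^ (-(3 / 2) : ℝ) := by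
      refine Summable.mul_left _ ?_
      have := (summable_nat_add_iff 1).2
        (Real.summable_nat_rpow (p := -(3 / 2)) |>.2 (by norm_num))
      simpa using this
    refine Summable.of_nonneg_of_le (fun n => abs_nonneg _) (fun n => ?_) hsum
    have hn : (0 : ℝ) < (n : ℝ) + 1 := by positivity
    have hd := hden n
    have hd0 : 0 < c + 2 * (n : ℝ) := hn.trans_le hd
    have hd1 : 0 < c + 2 * ((n : ℝ) + 1) := by linarith
    have hroot : ((n : ℝ) + 1 + 1) ^ (1 / 2 : ℝ) ≤ 2 * ((n : ℝ) + 1) ^ (1 / 2 : ℝ) := by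
      calc ((n : ℝ) + 1 + 1) ^ (1 / 2 : ℝ) ≤ (4 * ((n : ℝ) + 1)) ^ (1 / 2 : ℝ) :=
            Real.rpow_le_rpow (by positivity) (by linarith) (by norm_num)
        _ = 2 * ((n : ℝ) + 1) ^ (1 / 2 : ℝ) := by
            rw [Real.mul_rpow (by norm_num) hn.le]
            congr 1
            rw [show (4 : ℝ) = 2 ^ (2 : ℝ) by norm_num, ← Real.rpow_mul (by norm_num)]
            norm_num
    set ρ := ((n : ℝ) + 1) ^ (1 / 2 : ℝ) with hρ
    have hρ0 : 0 ≤ ρ := by positivity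
    have e1 : |u (n + 1)| ≤ C * K * (2 * ρ) := by
      have := hbound (n + 1)
      push_cast at this
      exact this.trans (mul_le_mul_of_nonneg_left hroot (by positivity))
    have e2 : |u (n + 1) - u n| ≤ C * K * (2 * ρ) / ((n : ℝ) + 1) := by
      refine (hu n).2.trans (div_le_div_of_nonneg_right ?_ hn.le)
      rw [mul_assoc]
      refine mul_le_mul_of_nonneg_left ((hKn (n + 1)).trans ?_) hC
      push_cast
      exact mul_le_mul_of_nonneg_left hroot hK
    have e3 : u (n + 1) / (c + 2 * ((n + 1 : ℕ) : ℝ)) - u n / (c + 2 * n)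
        = (u (n + 1) - u n) / (c + 2 * n)
          - 2 * u (n + 1) / ((c + 2 * n) * (c + 2 * ((n : ℝ) + 1))) := by
      push_cast
      field_simp
      ring
    have e4 : |(u (n + 1) - u n) / (c + 2 * n)| ≤ C * K * (2 * ρ) / ((n : ℝ) + 1) / ((n : ℝ) + 1) := by
      rw [abs_div, abs_of_pos hd0]
      exact div_le_div₀ (by positivity) e2 hn hd
    have e5 : |2 * u (n + 1) / ((c + 2 * n) * (c + 2 * ((n : ℝ) + 1)))|
        ≤ 2 * (C * K * (2 * ρ)) / (((n : ℝ) + 1) * ((n : ℝ) + 1)) := by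
      rw [abs_div, abs_mul, abs_of_pos (mul_pos hd0 hd1), abs_two]
      refine div_le_div₀ (by positivity) (by linarith) (by positivity) ?_
      exact mul_le_mul hd (by linarith) hn.le hd0.le
    have e6 : ((n : ℝ) + 1) ^ (-(3 / 2) : ℝ) = ρ / (((n : ℝ) + 1) * ((n : ℝ) + 1)) := by
      rw [hρ, show (-(3 / 2) : ℝ) = 1 / 2 - 1 - 1 by norm_num, Real.rpow_sub_one hn.ne',
        Real.rpow_sub_one hn.ne', div_div]
    rw [e3, e6]
    refine (abs_sub _ _).trans ((add_le_add e4 e5).trans (le_of_eq ?_))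
    field_simp
    ring
  exact exists_tendsto_alternating h0 hs'

/-! ### Chains of integers of alternating parity -/

/-- The contribution to `2 ^ r ∑ ∏ mᵢ ^ (-kᵢ)`, taken over all `kᵢ ≥ 1` with `∑ kᵢ = r + d`, of the
chains `0 < m₁ < ⋯ < m_r = r + 2 i` with `mᵢ ≡ i` modulo `2`. -/
def chainCoeff : ℕ → ℕ → ℕ → ℝ
  | 0, d, i => if d = 0 ∧ i = 0 then 1 else 0
  | r + 1, 0, i =>
    2 * (∑ l ∈ Finset.range (i + 1), chainCoeff r 0 l) / ((r : ℝ) + 1 + 2 * i)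
  | r + 1, d + 1, i =>
    (2 * (∑ l ∈ Finset.range (i + 1), chainCoeff r (d + 1) l) + chainCoeff (r + 1) d i)
      / ((r : ℝ) + 1 + 2 * i)

/-- The partial sums of `chainCoeff`. -/
def chainSum (r d j : ℕ) : ℝ := ∑ l ∈ Finset.range (j + 1), chainCoeff r d l

lemma chainCoeff_zero (d i : ℕ) : chainCoeff 0 d i = if d = 0 ∧ i = 0 then 1 else 0 := by
  rw [chainCoeff]

lemma chainCoeff_succ_zero (r i : ℕ) :
    chainCoeff (r + 1) 0 i = 2 * chainSum r 0 i / ((r : ℝ) + 1 + 2 * i) := by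
  rw [chainCoeff, chainSum]

lemma chainCoeff_succ_succ (r d i : ℕ) :
    chainCoeff (r + 1) (d + 1) i
      = (2 * chainSum r (d + 1) i + chainCoeff (r + 1) d i) / ((r : ℝ) + 1 + 2 * i) := by
  rw [chainCoeff, chainSum]

/-- Unrolling the recursion in d: the last exponent is e + 1, and the excess d - e is left to the
inner variables. -/
lemma chainCoeff_eq_sum (r d i : ℕ) :
    chainCoeff (r + 1) d i
      = ∑ e ∈ Finset.range (d + 1), 2 * chainSum r (d - e) i / ((r : ℝ) + 1 + 2 * i) ^ (e + 1) := by
  induction d with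
  | zero => simp [chainCoeff_succ_zero]
  | succ d ih =>
    rw [chainCoeff_succ_succ, ih, Finset.sum_range_succ' _ (d + 1), add_div, Finset.sum_div, add_comm]
    congr 1
    · refine Finset.sum_congr rfl fun e _ => ?_
      rw [Nat.add_sub_add_right, div_div, ← pow_succ]
    · simp

lemma chainSum_zero (d j : ℕ) : chainSum 0 d j = if d = 0 then 1 else 0 := by
  simp only [chainSum, chainCoeff_zero]
  rcases Nat.eq_zero_or_pos d with rfl | hd
  · simp
  · simp [hd.ne']

lemma chainSum_succ_index (r d j : ℕ) :
    chainSum r d (j + 1) = chainSum r d j + chainCoeff r d (j + 1) :=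
  Finset.sum_range_succ _ _

lemma chainSum_zero_index (r d : ℕ) : chainSum r d 0 = chainCoeff r d 0 := by
  simp [chainSum]

/-- Only one factor of the denominator is kept outside, in the shape required by `partialSum` and
`exists_tendsto`; the further powers are themselves slowly varying. -/
lemma slowlyVarying_chainCoeff_of {r : ℕ} (h : ∀ d, SlowlyVarying (chainSum r d)) (d : ℕ) :
    ∃ u : ℕ → ℝ, SlowlyVarying u ∧
      ∀ i, chainCoeff (r + 1) d i = u i / ((r : ℝ) + 1 + 2 * (i : ℝ)) := by
  have hr : (1 : ℝ) ≤ (r : ℝ) + 1 := by linarith [Nat.cast_nonneg (α := ℝ) r]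
  refine ⟨fun i => ∑ e ∈ Finset.range (d + 1),
    2 * chainSum r (d - e) i * (1 / ((r : ℝ) + 1 + 2 * i)) ^ e,
    SlowlyVarying.finset_sum _ fun e _ =>
      ((h (d - e)).const_mul 2).mul ((SlowlyVarying.inv_linear hr).pow e), fun i => ?_⟩
  rw [chainCoeff_eq_sum, Finset.sum_div]
  refine Finset.sum_congr rfl fun e _ => ?_
  rw [one_div, inv_pow, pow_succ, ← div_eq_mul_inv, div_div]

lemma slowlyVarying_chainSum (r d : ℕ) : SlowlyVarying (chainSum r d) := by
  induction r generalizing d with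
  | zero =>
    have : chainSum 0 d = fun _ => if d = 0 then 1 else 0 := funext fun j => chainSum_zero d j
    rw [this]; exact SlowlyVarying.const _
  | succ r ih =>
    obtain ⟨u, hu, hcu⟩ := slowlyVarying_chainCoeff_of ih d
    have hr : (1 : ℝ) ≤ (r : ℝ) + 1 := by linarith [Nat.cast_nonneg (α := ℝ) r]
    have : chainSum (r + 1) d
        = fun j => ∑ i ∈ Finset.range (j + 1), u i / ((r : ℝ) + 1 + 2 * (i : ℝ)) := by
      funext j
      rw [chainSum]
      exact Finset.sum_congr rfl fun i _ => hcu i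
    rw [this]; exact hu.partialSum hr

lemma exists_tendsto_chainCoeff (r d : ℕ) : ∃ L : ℝ,
    Tendsto (fun N => ∑ i ∈ Finset.range N, (-1 : ℝ) ^ i * chainCoeff (r + 1) d i) atTop (𝓝 L) := by
  obtain ⟨u, hu, hcu⟩ := slowlyVarying_chainCoeff_of (slowlyVarying_chainSum r) d
  obtain ⟨L, hL⟩ := hu.exists_tendsto (c := (r : ℝ) + 1) (by linarith [Nat.cast_nonneg (α := ℝ) r])
  exact ⟨L, by simpa only [hcu] using hL⟩

lemma exists_chainCoeff_le (r d : ℕ) :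
    ∃ (C : ℝ) (k : ℕ), ∀ n : ℕ, |chainCoeff r d n| ≤ C * ((n : ℝ) + 1) ^ k := by
  cases r with
  | zero =>
    refine ⟨1, 0, fun n => ?_⟩
    rw [chainCoeff_zero]; split_ifs <;> simp
  | succ r =>
    obtain ⟨u, hu, hcu⟩ := slowlyVarying_chainCoeff_of (slowlyVarying_chainSum r) d
    obtain ⟨C, k, h⟩ := hu.exists_le_pow
    refine ⟨C, k, fun n => le_trans ?_ (h n)⟩
    have h1 : (1 : ℝ) ≤ (r : ℝ) + 1 + 2 * (n : ℝ) := by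
      linarith [Nat.cast_nonneg (α := ℝ) r, Nat.cast_nonneg (α := ℝ) n]
    rw [hcu, abs_div, abs_of_pos (by linarith : 0 < (r : ℝ) + 1 + 2 * (n : ℝ))]
    exact div_le_self (abs_nonneg _) h1

/-! ### Finite sums over increasing tuples -/

lemma mem_increasingTuples {r N : ℕ} {a : Fin r → ℕ} :
    a ∈ increasingTuples r N ↔ (∀ i, 1 ≤ a i ∧ a i ≤ N) ∧ StrictMono a := by
  simp [increasingTuples]

lemma strictMono_snoc {r : ℕ} {b : Fin r → ℕ} {n : ℕ} :
    StrictMono (Fin.snoc b n : Fin (r + 1) → ℕ) ↔ StrictMono b ∧ ∀ i, b i < n := by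
  constructor
  · intro h
    refine ⟨fun i j hij => ?_, fun i => ?_⟩
    · simpa using h (show i.castSucc < j.castSucc from hij)
    · simpa using h (Fin.castSucc_lt_last i)
  · rintro ⟨h1, h2⟩ i j
    refine Fin.lastCases ?_ (fun j => ?_) j
    · refine Fin.lastCases ?_ (fun i => ?_) i
      · intro h; exact absurd h (lt_irrefl _)
      · intro _; simpa using h2 i
    · refine Fin.lastCases ?_ (fun i => ?_) i
      · intro h; exact absurd h (not_lt.2 (Fin.le_last _))
      · intro h; simpa using h1 (show i < j from h)

lemma forall_snoc_iff {r : ℕ} {b : Fin r → ℕ} {n : ℕ} {P : ℕ → Prop} :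
    (∀ i, P ((Fin.snoc b n : Fin (r + 1) → ℕ) i)) ↔ (∀ i, P (b i)) ∧ P n := by
  rw [Fin.forall_fin_succ']
  simp

lemma sum_increasingTuples_succ {r : ℕ} (N : ℕ) (f : (Fin (r + 1) → ℕ) → ℝ) :
    ∑ a ∈ increasingTuples (r + 1) N, f a
      = ∑ n ∈ Finset.Icc 1 N, ∑ b ∈ increasingTuples r (n - 1), f (Fin.snoc b n) := by
  rw [Finset.sum_sigma']
  refine Finset.sum_nbij' (fun a => ⟨a (Fin.last r), Fin.init a⟩) (fun x => Fin.snoc x.2 x.1)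
    ?_ ?_ ?_ ?_ ?_
  · intro a ha
    obtain ⟨b, n, rfl⟩ : ∃ (b : Fin r → ℕ) (n : ℕ), a = Fin.snoc b n :=
      ⟨Fin.init a, a (Fin.last r), (Fin.snoc_init_self a).symm⟩
    rw [mem_increasingTuples, strictMono_snoc,
      forall_snoc_iff (P := fun x => 1 ≤ x ∧ x ≤ N)] at ha
    simp only [Fin.snoc_last, Fin.init_snoc, Finset.mem_sigma, Finset.mem_Icc, mem_increasingTuples]
    exact ⟨ha.1.2, fun i => ⟨(ha.1.1 i).1, by have := ha.2.2 i; omega⟩, ha.2.1⟩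
  · rintro ⟨n, b⟩ h
    simp only [Finset.mem_sigma, Finset.mem_Icc, mem_increasingTuples] at h
    rw [mem_increasingTuples, strictMono_snoc, forall_snoc_iff (P := fun x => 1 ≤ x ∧ x ≤ N)]
    obtain ⟨h1, h2, h3⟩ := h
    refine ⟨⟨fun i => ?_, h1⟩, h3, fun i => ?_⟩
    · have := h2 i
      change 1 ≤ b i ∧ b i ≤ N
      omega
    · have := h2 i
      change b i < n
      omega
  · intro a _
    exact Fin.snoc_init_self a
  · rintro ⟨n, b⟩ _
    simp
  · intro a _
    simp

/-- The finite sums `2 ^ r ∑_{0 < n₁ < ⋯ < n_r ≤ N} ∏ (2 nᵢ - i) ^ (-kᵢ)`. -/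
def tuplesSum {r : ℕ} (k : Fin r → ℕ) (N : ℕ) : ℝ :=
  ∑ a ∈ increasingTuples r N, ∏ i : Fin r, 2 / (2 * (a i : ℝ) - ((i : ℕ) + 1)) ^ k i

lemma tuplesSum_zero (k : Fin 0 → ℕ) (N : ℕ) : tuplesSum k N = 1 := by
  have : increasingTuples 0 N = {Fin.elim0} := by
    ext a
    simp [mem_increasingTuples, Subsingleton.elim a Fin.elim0, StrictMono]
  simp [tuplesSum, this]

lemma tuplesSum_snoc {r : ℕ} (k : Fin r → ℕ) (l N : ℕ) :
    tuplesSum (Fin.snoc k l : Fin (r + 1) → ℕ) N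
      = ∑ n ∈ Finset.Icc 1 N, 2 / (2 * (n : ℝ) - (r + 1)) ^ l * tuplesSum k (n - 1) := by
  rw [tuplesSum, sum_increasingTuples_succ]
  refine Finset.sum_congr rfl fun n _ => ?_
  rw [tuplesSum, Finset.mul_sum]
  refine Finset.sum_congr rfl fun b _ => ?_
  rw [Fin.prod_univ_castSucc, mul_comm]
  simp

/-- The sign involves only the outermost variable, so the inner sum is the unsigned `tuplesSum`. -/
lemma tbarTrunc_snoc {r : ℕ} (k : Fin r → ℕ) (l N : ℕ) :
    tbarTrunc (Fin.snoc k l : Fin (r + 1) → ℕ) N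
      = ∑ n ∈ Finset.Icc 1 N,
        (-1 : ℝ) ^ n * (2 / (2 * (n : ℝ) - (r + 1)) ^ l * tuplesSum k (n - 1)) := by
  rw [tbarTrunc, sum_increasingTuples_succ, Finset.mul_sum]
  refine Finset.sum_congr rfl fun n _ => ?_
  rw [tuplesSum, Finset.mul_sum, Finset.mul_sum, Finset.mul_sum]
  refine Finset.sum_congr rfl fun b _ => ?_
  have h1 : lastEntry (Fin.snoc b n : Fin (r + 1) → ℕ) = n := by
    rw [lastEntry, ← Fin.succ_last, Fin.cons_succ, Fin.snoc_last]
  have h2 : ∏ i : Fin r, (2 : ℝ) / (2 * (b i : ℝ) - ((i : ℕ) + 1)) ^ k i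
      = 2 ^ r / ∏ i : Fin r, (2 * (b i : ℝ) - ((i : ℕ) + 1)) ^ k i := by
    rw [Finset.prod_div_distrib]; simp
  rw [h1, h2, Fin.prod_univ_castSucc]
  simp only [Fin.snoc_castSucc, Fin.snoc_last, Fin.val_castSucc, Fin.val_last]
  rw [pow_succ, div_mul_div_comm, mul_div_assoc', mul_div_assoc']
  congr 1 <;> ring

/-- There is no room for r distinct integers in [1, N]. This also removes the values n ≤ r of the
next variable, for which 2n - (r + 1) may be zero or negative. -/
lemma tuplesSum_eq_zero {r : ℕ} (k : Fin r → ℕ) {N : ℕ} (h : N < r) : tuplesSum k N = 0 := by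
  rw [tuplesSum]
  have : increasingTuples r N = ∅ := by
    refine Finset.eq_empty_of_forall_notMem fun a ha => ?_
    rw [mem_increasingTuples] at ha
    have h1 : Fintype.card (Fin r) ≤ (Finset.Icc 1 N).card := by
      refine Finset.card_le_card_of_injOn a (fun i _ => ?_) ha.2.injective.injOn
      simpa using ha.1 i
    simp at h1
    omega
  simp [this]

lemma sum_Icc_eq_sum_range {M : Type*} [AddCommMonoid M] (f : ℕ → M) (N : ℕ) :
    ∑ n ∈ Finset.Icc 1 N, f n = ∑ n ∈ Finset.range N, f (n + 1) := by
  rw [Finset.range_eq_Ico, Finset.sum_Ico_add' f 0 N 1]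
  rfl

lemma sum_Icc_shift {M : Type*} [AddCommMonoid M] (f : ℕ → M) (r j : ℕ)
    (hf : ∀ n, 1 ≤ n → n ≤ r → f n = 0) :
    ∑ n ∈ Finset.Icc 1 (r + j), f n = ∑ i ∈ Finset.range j, f (r + 1 + i) := by
  rw [sum_Icc_eq_sum_range, Finset.sum_range_add, Finset.sum_eq_zero, zero_add]
  · exact Finset.sum_congr rfl fun i _ => by congr 1; omega
  · intro n hn
    exact hf _ (by omega) (by simpa using hn)

/-- With n = r + 1 + i the denominator 2n - (r + 1) becomes r + 1 + 2i, as in `chainCoeff`. -/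
lemma tuplesSum_snoc_shift {r : ℕ} (k : Fin r → ℕ) (l j : ℕ) :
    tuplesSum (Fin.snoc k l : Fin (r + 1) → ℕ) (r + 1 + j)
      = ∑ i ∈ Finset.range (j + 1), 2 / ((r : ℝ) + 1 + 2 * i) ^ l * tuplesSum k (r + i) := by
  rw [tuplesSum_snoc, show r + 1 + j = r + (j + 1) by omega, sum_Icc_shift]
  · refine Finset.sum_congr rfl fun i _ => ?_
    rw [show r + 1 + i - 1 = r + i by omega]
    congr 3
    push_cast; ring
  · intro n h1 h2
    rw [tuplesSum_eq_zero k (by omega), mul_zero]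

lemma tbarTrunc_snoc_shift {r : ℕ} (k : Fin r → ℕ) (l j : ℕ) :
    tbarTrunc (Fin.snoc k l : Fin (r + 1) → ℕ) (r + j)
      = (-1) ^ (r + 1) * ∑ i ∈ Finset.range j,
        (-1 : ℝ) ^ i * (2 / ((r : ℝ) + 1 + 2 * i) ^ l * tuplesSum k (r + i)) := by
  rw [tbarTrunc_snoc, sum_Icc_shift, Finset.mul_sum]
  · refine Finset.sum_congr rfl fun i _ => ?_
    rw [show r + 1 + i - 1 = r + i by omega, pow_add, mul_assoc]
    congr 5
    push_cast; ring
  · intro n h1 h2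
    rw [tuplesSum_eq_zero k (by omega), mul_zero, mul_zero]

lemma slowlyVarying_tuplesSum {r : ℕ} (k : Fin r → ℕ) (hk : ∀ i, 1 ≤ k i) :
    SlowlyVarying fun j => tuplesSum k (r + j) := by
  induction r with
  | zero => simpa [tuplesSum_zero] using SlowlyVarying.const 1
  | succ r ih =>
    obtain ⟨b, l, rfl⟩ : ∃ (b : Fin r → ℕ) (l : ℕ), k = Fin.snoc b l :=
      ⟨Fin.init k, k (Fin.last r), (Fin.snoc_init_self k).symm⟩
    rw [forall_snoc_iff (P := fun x => 1 ≤ x)] at hk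
    obtain ⟨l, rfl⟩ : ∃ l', l = l' + 1 := ⟨l - 1, by omega⟩
    have hr : (1 : ℝ) ≤ (r : ℝ) + 1 := by linarith [Nat.cast_nonneg (α := ℝ) r]
    have := (((SlowlyVarying.inv_linear hr).pow l).const_mul 2).mul (ih b hk.1) |>.partialSum hr
    convert this using 2 with j
    rw [tuplesSum_snoc_shift]
    refine Finset.sum_congr rfl fun i _ => ?_
    rw [one_div, inv_pow, pow_succ, ← div_eq_mul_inv, div_mul_eq_mul_div, div_mul_eq_mul_div,
      div_div]

/-- The inner sum is slowly varying and the outermost one alternates, so convergence holds even for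
last exponent 1. -/
lemma exists_tendsto_tbarTrunc {r : ℕ} (k : Fin (r + 1) → ℕ) (hk : ∀ i, 1 ≤ k i) :
    ∃ L : ℝ, Tendsto (tbarTrunc k) atTop (𝓝 L) := by
  obtain ⟨b, l, rfl⟩ : ∃ (b : Fin r → ℕ) (l : ℕ), k = Fin.snoc b l :=
    ⟨Fin.init k, k (Fin.last r), (Fin.snoc_init_self k).symm⟩
  rw [forall_snoc_iff (P := fun x => 1 ≤ x)] at hk
  obtain ⟨l, rfl⟩ : ∃ l', l = l' + 1 := ⟨l - 1, by omega⟩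
  have hr : (1 : ℝ) ≤ (r : ℝ) + 1 := by linarith [Nat.cast_nonneg (α := ℝ) r]
  obtain ⟨L, hL⟩ := ((((SlowlyVarying.inv_linear hr).pow l).const_mul 2).mul
    (slowlyVarying_tuplesSum b hk.1)).exists_tendsto hr
  refine ⟨(-1) ^ (r + 1) * L, (tendsto_add_atTop_iff_nat r).1 ?_⟩
  refine (hL.const_mul _).congr fun N => ?_
  rw [add_comm N r, tbarTrunc_snoc_shift]
  congr 1
  refine Finset.sum_congr rfl fun i _ => ?_
  congr 1
  rw [one_div, inv_pow, pow_succ, ← div_eq_mul_inv, div_mul_eq_mul_div, div_mul_eq_mul_div, div_div]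

/-! ### Sums over all indices of given weight and depth -/

lemma mem_indexSet {k r : ℕ} {a : Fin r → ℕ} :
    a ∈ indexSet k r ↔ (∀ i, 1 ≤ a i) ∧ ∑ i, a i = k := by
  simp only [indexSet, Finset.mem_filter, Fintype.mem_piFinset, Finset.mem_Icc]
  refine ⟨fun h => ⟨fun i => (h.1 i).1, h.2⟩, fun h => ⟨fun i => ⟨h.1 i, ?_⟩, h.2⟩⟩
  rw [← h.2]
  exact Finset.single_le_sum (fun j _ => Nat.zero_le (a j)) (Finset.mem_univ i)

lemma le_of_mem_indexSet {k r : ℕ} {a : Fin r → ℕ} (h : a ∈ indexSet k r) : r ≤ k := by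
  rw [mem_indexSet] at h
  rw [← h.2]
  simpa using Finset.sum_le_sum fun i (_ : i ∈ Finset.univ) => h.1 i

lemma sum_indexSet_succ (r d : ℕ) (f : (Fin (r + 1) → ℕ) → ℝ) :
    ∑ k ∈ indexSet (r + 1 + d) (r + 1), f k
      = ∑ e ∈ Finset.range (d + 1), ∑ k ∈ indexSet (r + (d - e)) r, f (Fin.snoc k (e + 1)) := by
  rw [Finset.sum_sigma']
  refine Finset.sum_nbij' (fun a => ⟨a (Fin.last r) - 1, Fin.init a⟩)
    (fun x => Fin.snoc x.2 (x.1 + 1)) ?_ ?_ ?_ ?_ ?_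
  · intro a ha
    obtain ⟨b, n, rfl⟩ : ∃ (b : Fin r → ℕ) (n : ℕ), a = Fin.snoc b n :=
      ⟨Fin.init a, a (Fin.last r), (Fin.snoc_init_self a).symm⟩
    rw [mem_indexSet, forall_snoc_iff (P := fun x => 1 ≤ x), Fin.sum_univ_castSucc] at ha
    simp only [Fin.snoc_castSucc, Fin.snoc_last] at ha
    have hb : b ∈ indexSet (∑ i, b i) r := mem_indexSet.2 ⟨ha.1.1, rfl⟩
    have := le_of_mem_indexSet hb
    simp only [Fin.snoc_last, Fin.init_snoc, Finset.mem_sigma, Finset.mem_range, mem_indexSet]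
    exact ⟨by omega, ha.1.1, by omega⟩
  · rintro ⟨n, b⟩ h
    simp only [Finset.mem_sigma, Finset.mem_range, mem_indexSet] at h
    rw [mem_indexSet, forall_snoc_iff (P := fun x => 1 ≤ x), Fin.sum_univ_castSucc]
    simp only [Fin.snoc_castSucc, Fin.snoc_last]
    exact ⟨⟨h.2.1, by omega⟩, by omega⟩
  · intro a ha
    rw [mem_indexSet] at ha
    have := ha.1 (Fin.last r)
    simp only [Nat.sub_add_cancel this]
    exact Fin.snoc_init_self a
  · rintro ⟨n, b⟩ _
    simp
  · intro a ha
    rw [mem_indexSet] at ha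
    have := ha.1 (Fin.last r)
    simp only [Nat.sub_add_cancel this]
    rw [Fin.snoc_init_self]

/-- Peeling off the last variable together with its exponent e + 1 reproduces the recursion of
`chainCoeff`. -/
lemma sum_tuplesSum (r d j : ℕ) :
    ∑ k ∈ indexSet (r + d) r, tuplesSum k (r + j) = chainSum r d j := by
  induction r generalizing d j with
  | zero =>
    rw [chainSum_zero]
    rcases Nat.eq_zero_or_pos d with rfl | hd
    · have : indexSet (0 + 0) 0 = {Fin.elim0} := by
        ext a
        simp [mem_indexSet, Subsingleton.elim a Fin.elim0]
      simp [this, tuplesSum_zero]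
    · have : indexSet (0 + d) 0 = ∅ := by
        ext a
        simp [mem_indexSet]
        omega
      rw [this, Finset.sum_empty, if_neg hd.ne']
  | succ r ih =>
    rw [sum_indexSet_succ, chainSum]
    simp only [tuplesSum_snoc_shift, chainCoeff_eq_sum]
    rw [Finset.sum_comm (s := Finset.range (j + 1))]
    refine Finset.sum_congr rfl fun e _ => ?_
    rw [Finset.sum_comm]
    refine Finset.sum_congr rfl fun i _ => ?_
    rw [← Finset.mul_sum, ih, div_mul_eq_mul_div]

lemma sum_tbarTrunc (r d j : ℕ) :
    ∑ k ∈ indexSet (r + 1 + d) (r + 1), tbarTrunc k (r + j)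
      = (-1) ^ (r + 1) * ∑ i ∈ Finset.range j, (-1 : ℝ) ^ i * chainCoeff (r + 1) d i := by
  rw [sum_indexSet_succ]
  simp only [tbarTrunc_snoc_shift, chainCoeff_eq_sum, Finset.mul_sum]
  rw [Finset.sum_comm (s := Finset.range j)]
  refine Finset.sum_congr rfl fun e _ => ?_
  rw [Finset.sum_comm]
  refine Finset.sum_congr rfl fun i _ => ?_
  rw [← sum_tuplesSum, Finset.mul_sum, Finset.sum_div, Finset.mul_sum, Finset.mul_sum]
  refine Finset.sum_congr rfl fun k _ => ?_
  rw [div_mul_eq_mul_div]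

/-- The sign comes from n = r + 1 + i for the outermost variable. -/
lemma tendsto_chainCoeff_W (r d : ℕ) :
    Tendsto (fun N => ∑ i ∈ Finset.range N, (-1 : ℝ) ^ i * chainCoeff (r + 1) d i) atTop
      (𝓝 ((-1) ^ (r + 1) * W (r + 1 + d) (r + 1))) := by
  have h1 : Tendsto (fun N => ∑ k ∈ indexSet (r + 1 + d) (r + 1), tbarTrunc k N) atTop
      (𝓝 (W (r + 1 + d) (r + 1))) :=
    tendsto_finsetSum _ fun k hk =>
      tendsto_nhds_limUnder (exists_tendsto_tbarTrunc k (mem_indexSet.1 hk).1)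
  have h2 := ((tendsto_add_atTop_iff_nat r).2 h1).const_mul ((-1 : ℝ) ^ (r + 1))
  refine h2.congr fun N => ?_
  rw [add_comm N r, sum_tbarTrunc, ← mul_assoc, ← mul_pow]
  simp

/-! ### Multiple `T`-harmonic sums -/

lemma monotone_snoc_of {r n : ℕ} {a : Fin r → ℕ}
    (h : ∀ i : Fin r,
      if Even (i : ℕ) then
        (Fin.snoc a n : Fin (r + 1) → ℕ) i.castSucc ≤ (Fin.snoc a n : Fin (r + 1) → ℕ) i.succ
      else
        (Fin.snoc a n : Fin (r + 1) → ℕ) i.castSucc < (Fin.snoc a n : Fin (r + 1) → ℕ) i.succ) :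
    Monotone (Fin.snoc a n : Fin (r + 1) → ℕ) := by
  rw [Fin.monotone_iff_le_succ]
  intro i
  have := h i
  split_ifs at this
  · exact this
  · exact this.le

lemma mem_tTuples {r n : ℕ} {a : Fin r → ℕ} :
    a ∈ tTuples r n ↔ (∀ i, 1 ≤ a i) ∧ ∀ i : Fin r,
      if Even (i : ℕ) then
        (Fin.snoc a n : Fin (r + 1) → ℕ) i.castSucc ≤ (Fin.snoc a n : Fin (r + 1) → ℕ) i.succ
      else
        (Fin.snoc a n : Fin (r + 1) → ℕ) i.castSucc < (Fin.snoc a n : Fin (r + 1) → ℕ) i.succ := by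
  rw [tTuples, Finset.mem_filter]
  simp only [Fintype.mem_piFinset, Finset.mem_Icc]
  refine ⟨fun h => ⟨fun i => (h.1 i).1, h.2⟩, fun h => ⟨fun i => ⟨h.1 i, ?_⟩, h.2⟩⟩
  simpa using monotone_snoc_of h.2 (Fin.castSucc_lt_last i).le

lemma snoc_mem_tTuples {r n l : ℕ} {b : Fin r → ℕ} :
    (Fin.snoc b l : Fin (r + 1) → ℕ) ∈ tTuples (r + 1) n ↔
      (1 ≤ l ∧ if Even r then l ≤ n else l < n) ∧ b ∈ tTuples r l := by
  rw [mem_tTuples, mem_tTuples, forall_snoc_iff (P := fun x => 1 ≤ x), Fin.forall_fin_succ']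
  simp only [Fin.snoc_castSucc, Fin.succ_castSucc, Fin.val_castSucc, Fin.snoc_last, Fin.succ_last,
    Fin.val_last]
  tauto

lemma sum_tTuples_succ (r n : ℕ) (f : (Fin (r + 1) → ℕ) → ℝ) :
    ∑ a ∈ tTuples (r + 1) n, f a
      = ∑ l ∈ Finset.Icc 1 (if Even r then n else n - 1), ∑ b ∈ tTuples r l, f (Fin.snoc b l) := by
  have hmem : ∀ l, l ∈ Finset.Icc 1 (if Even r then n else n - 1) ↔
      (1 ≤ l ∧ if Even r then l ≤ n else l < n) := by
    intro l
    rw [Finset.mem_Icc]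
    split_ifs <;> omega
  rw [Finset.sum_sigma']
  refine Finset.sum_nbij' (fun a => ⟨a (Fin.last r), Fin.init a⟩) (fun x => Fin.snoc x.2 x.1)
    ?_ ?_ ?_ ?_ ?_
  · intro a ha
    rw [← Fin.snoc_init_self a, snoc_mem_tTuples] at ha
    rw [Finset.mem_sigma, hmem]
    exact ha
  · rintro ⟨l, b⟩ h
    rw [Finset.mem_sigma, hmem] at h
    exact snoc_mem_tTuples.2 h
  · intro a _
    exact Fin.snoc_init_self a
  · rintro ⟨l, b⟩ _
    simp
  · intro a _
    simp

lemma tHarm_ones_zero (n : ℕ) : tHarm (ones 0) n = 1 := by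
  have : tTuples 0 n = {Fin.elim0} := by
    ext a
    simp [mem_tTuples, Subsingleton.elim a Fin.elim0]
  simp [tHarm, this]

lemma tHarm_ones_succ (r n : ℕ) :
    tHarm (ones (r + 1)) n = ∑ l ∈ Finset.Icc 1 (if Even r then n else n - 1),
      2 * tHarm (ones r) l / (if Even r then 2 * (l : ℝ) - 1 else 2 * (l : ℝ)) := by
  rw [tHarm, sum_tTuples_succ]
  refine Finset.sum_congr rfl fun l _ => ?_
  rw [tHarm, Finset.mul_sum, Finset.sum_div]
  refine Finset.sum_congr rfl fun b _ => ?_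
  rw [Fin.prod_univ_castSucc]
  simp only [Fin.snoc_castSucc, Fin.snoc_last, Fin.val_castSucc, Fin.val_last, ones, pow_one]
  rw [pow_succ, mul_div_assoc', div_div, mul_comm (2 ^ r : ℝ)]

/-- The pattern ≤, < says exactly that 2n₁ - 1 < 2n₂ < 2n₃ - 1 < ⋯, a chain whose i-th entry has the
parity of i. For n = a + 1 + j its last entry is at most 2n - 2 = 2a + 2j, the bound in `chainSum`;
all exponents are 1, hence d = 0. The induction passes through the odd depth 2a + 1, where the bound
is 2n - 1. -/
lemma tHarm_ones_even (a : ℕ) :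
    (∀ n, 1 ≤ n → n ≤ a → tHarm (ones (2 * a)) n = 0) ∧
      ∀ j, tHarm (ones (2 * a)) (a + 1 + j) = chainSum (2 * a) 0 j := by
  induction a with
  | zero =>
    refine ⟨fun n h1 h2 => by omega, fun j => ?_⟩
    rw [chainSum_zero, if_pos rfl]
    exact tHarm_ones_zero _
  | succ a ih =>
    obtain ⟨ih1, ih2⟩ := ih
    have odd_zero : ∀ n, n ≤ a → tHarm (ones (2 * a + 1)) n = 0 := by
      intro n hn
      rw [tHarm_ones_succ, if_pos (even_two_mul a)]
      refine Finset.sum_eq_zero fun l hl => ?_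
      rw [Finset.mem_Icc] at hl
      rw [ih1 l hl.1 (hl.2.trans hn)]
      simp
    have odd_shift : ∀ j, tHarm (ones (2 * a + 1)) (a + 1 + j) = chainSum (2 * a + 1) 0 j := by
      intro j
      rw [tHarm_ones_succ, if_pos (even_two_mul a), show a + 1 + j = a + (j + 1) by omega,
        sum_Icc_shift, chainSum]
      · refine Finset.sum_congr rfl fun i _ => ?_
        rw [ih2, chainCoeff_succ_zero, if_pos (even_two_mul a)]
        congr 1
        push_cast; ring
      · intro n h1 h2
        rw [ih1 n h1 h2]; simp
    have hodd : ¬ Even (2 * a + 1) := by simp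
    refine ⟨fun n h1 h2 => ?_, fun j => ?_⟩
    · rw [show 2 * (a + 1) = 2 * a + 1 + 1 by ring, tHarm_ones_succ, if_neg hodd]
      refine Finset.sum_eq_zero fun l hl => ?_
      rw [Finset.mem_Icc] at hl
      rw [odd_zero l (by omega)]
      simp
    · rw [show 2 * (a + 1) = 2 * a + 1 + 1 by ring, tHarm_ones_succ, if_neg hodd,
        show a + 1 + 1 + j - 1 = a + (j + 1) by omega, sum_Icc_shift, chainSum]
      · refine Finset.sum_congr rfl fun i _ => ?_
        rw [odd_shift, chainCoeff_succ_zero, if_neg hodd]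
        congr 1
        push_cast; ring
      · intro n h1 h2
        rw [odd_zero n h2]; simp

/-! ### The recursion for `Z` -/

lemma mem_chains {j p k : ℕ} {i : Fin (k + 1) → ℕ} :
    i ∈ chains j p k ↔ StrictMono i ∧ i 0 = j ∧ i (Fin.last k) = p := by
  rw [chains, Finset.mem_filter, Fintype.mem_piFinset]
  refine ⟨fun h => h.2, fun h => ⟨fun l => Finset.mem_Icc.2 ⟨?_, ?_⟩, h⟩⟩
  · rw [← h.2.1]; exact h.1.monotone (Fin.zero_le l)
  · rw [← h.2.2]; exact h.1.monotone (Fin.le_last l)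

lemma sum_chains_succ (j p k : ℕ) (f : (Fin (k + 2) → ℕ) → ℝ) :
    ∑ i ∈ chains j p (k + 1), f i
      = ∑ q ∈ Finset.Ico j p, ∑ b ∈ chains j q k, f (Fin.snoc b p) := by
  rw [Finset.sum_sigma']
  refine Finset.sum_nbij' (fun i => ⟨(Fin.init i : Fin (k + 1) → ℕ) (Fin.last k), Fin.init i⟩)
    (fun x => Fin.snoc x.2 p) ?_ ?_ ?_ ?_ ?_
  · intro i hi
    obtain ⟨b, n, rfl⟩ : ∃ (b : Fin (k + 1) → ℕ) (n : ℕ), i = Fin.snoc b n :=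
      ⟨Fin.init i, i (Fin.last _), (Fin.snoc_init_self i).symm⟩
    rw [mem_chains, strictMono_snoc, Fin.snoc_last, ← Fin.castSucc_zero, Fin.snoc_castSucc] at hi
    obtain ⟨⟨h1, h2⟩, h3, rfl⟩ := hi
    rw [Finset.mem_sigma, Finset.mem_Ico, mem_chains]
    simp only [Fin.init_snoc]
    refine ⟨⟨?_, h2 _⟩, h1, h3, trivial⟩
    rw [← h3]; exact h1.monotone (Fin.zero_le _)
  · rintro ⟨q, b⟩ h
    rw [Finset.mem_sigma, Finset.mem_Ico, mem_chains] at h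
    obtain ⟨⟨h1, h2⟩, h3, h4, h5⟩ := h
    change (Fin.snoc b p : Fin (k + 2) → ℕ) ∈ _
    rw [mem_chains, strictMono_snoc, Fin.snoc_last, ← Fin.castSucc_zero, Fin.snoc_castSucc]
    refine ⟨⟨h3, fun i => lt_of_le_of_lt (h3.monotone (Fin.le_last i)) ?_⟩, h4, rfl⟩
    exact lt_of_eq_of_lt h5 h2
  · intro i hi
    rw [mem_chains] at hi
    conv_rhs => rw [← Fin.snoc_init_self i, hi.2.2]
  · rintro ⟨q, b⟩ h
    rw [Finset.mem_sigma, mem_chains] at h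
    have h5 : b (Fin.last k) = q := h.2.2.2
    subst h5
    simp
  · intro i hi
    rw [mem_chains] at hi
    conv_lhs => rw [← Fin.snoc_init_self i, hi.2.2]

/-- The sum over the chains `j = i₀ < ⋯ < i_k = p` of `∏ -2 ζ̄(2 i_l - 2 i_{l-1})`. -/
def chainWeight (j p k : ℕ) : ℝ :=
  ∑ i ∈ chains j p k, ∏ l : Fin k, -2 * zetaBar (2 * i l.succ - 2 * i l.castSucc)

lemma chainWeight_succ (j p k : ℕ) :
    chainWeight j p (k + 1)
      = ∑ q ∈ Finset.Ico j p, chainWeight j q k * (-2 * zetaBar (2 * p - 2 * q)) := by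
  rw [chainWeight, sum_chains_succ]
  refine Finset.sum_congr rfl fun q _ => ?_
  rw [chainWeight, Finset.sum_mul]
  refine Finset.sum_congr rfl fun b hb => ?_
  rw [mem_chains] at hb
  rw [Fin.prod_univ_castSucc]
  simp only [Fin.succ_castSucc, Fin.snoc_castSucc, Fin.succ_last, Fin.snoc_last]
  rw [hb.2.2]

lemma chainWeight_eq_zero {j p k : ℕ} (h : p < j + k) : chainWeight j p k = 0 := by
  rw [chainWeight]
  have : chains j p k = ∅ := by
    refine Finset.eq_empty_of_forall_notMem fun i hi => ?_
    rw [mem_chains] at hi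
    have h1 : (Finset.univ : Finset (Fin (k + 1))).card ≤ (Finset.Icc j p).card := by
      refine Finset.card_le_card_of_injOn i (fun l _ => ?_) hi.1.injective.injOn
      rw [Finset.coe_Icc, Set.mem_Icc]
      constructor
      · rw [← hi.2.1]; exact hi.1.monotone (Fin.zero_le l)
      · rw [← hi.2.2]; exact hi.1.monotone (Fin.le_last l)
    simp at h1
    omega
  rw [this, Finset.sum_empty]

lemma chainWeight_zero (j p : ℕ) : chainWeight j p 0 = if j = p then 1 else 0 := by
  rw [chainWeight]
  split_ifs with h
  · have : chains j p 0 = {fun _ => j} := by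
      ext i
      rw [mem_chains, Finset.mem_singleton]
      constructor
      · intro hi
        funext l
        rw [Fin.fin_one_eq_zero l, hi.2.1]
      · rintro rfl
        exact ⟨fun a b hab => absurd hab (by simp [Fin.fin_one_eq_zero a, Fin.fin_one_eq_zero b]), rfl, h⟩
    rw [this]
    simp
  · have : chains j p 0 = ∅ := by
      refine Finset.eq_empty_of_forall_notMem fun i hi => h ?_
      rw [mem_chains] at hi
      rw [← hi.2.1, ← hi.2.2]
      rfl
    rw [this, Finset.sum_empty]

/-- Chains with more than p - j links do not exist, and chains with no link account for j = p. The
free bound M lets different q share one range of summation in `Z_of_lt`. -/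
lemma Z_eq_sum_chainWeight {j p M : ℕ} (hM : p < j + M) :
    Z j p = ∑ k ∈ Finset.range M, chainWeight j p k := by
  rw [Z]
  split_ifs with h
  · subst h
    obtain ⟨M, rfl⟩ : ∃ M', M = M' + 1 := ⟨M - 1, by omega⟩
    rw [Finset.sum_range_succ', chainWeight_zero, if_pos rfl, Finset.sum_eq_zero, zero_add]
    intro k _
    exact chainWeight_eq_zero (by omega)
  · have h1 : ∑ k ∈ Finset.range M, chainWeight j p k
        = ∑ k ∈ Finset.Icc 1 (p - j), chainWeight j p k := by
      symm
      refine Finset.sum_subset (fun k hk => ?_) fun k _ hk => ?_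
      · rw [Finset.mem_Icc] at hk
        rw [Finset.mem_range]; omega
      · rw [Finset.mem_Icc] at hk
        rcases Nat.eq_zero_or_pos k with rfl | hk0
        · rw [chainWeight_zero, if_neg h]
        · exact chainWeight_eq_zero (by omega)
    rw [h1]
    refine Finset.sum_congr rfl fun k _ => ?_
    rw [chainWeight, Finset.mul_sum]
    refine Finset.sum_congr rfl fun i _ => ?_
    rw [Finset.prod_mul_distrib]
    simp

lemma Z_self (p : ℕ) : Z p p = 1 := by simp [Z]

/-- Removing the last link q → p of a chain; q = j is the chain with a single link. -/
lemma Z_of_lt {j p : ℕ} (h : j < p) :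
    Z j p = ∑ q ∈ Finset.Ico j p, Z j q * (-2 * zetaBar (2 * p - 2 * q)) := by
  rw [Z_eq_sum_chainWeight (M := p - j + 1) (by omega), Finset.sum_range_succ', chainWeight_zero,
    if_neg h.ne, add_zero]
  simp only [chainWeight_succ]
  rw [Finset.sum_comm]
  refine Finset.sum_congr rfl fun q hq => ?_
  rw [Finset.mem_Ico] at hq
  rw [Z_eq_sum_chainWeight (M := p - j) (by omega), Finset.sum_mul]

/-- Convolution with `Z` inverts convolution with the sequence `1, 2 ζ̄(2), 2 ζ̄(4), …`. -/
lemma eq_sum_Z {X Y : ℕ → ℝ} {p : ℕ}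
    (h : ∀ j ∈ Finset.Icc 1 p,
      Y j = X j + ∑ q ∈ Finset.Ico 1 j, 2 * zetaBar (2 * j - 2 * q) * X q) :
    ∀ j ∈ Finset.Icc 1 p, X j = ∑ i ∈ Finset.Icc 1 j, Y i * Z i j := by
  intro j
  induction j using Nat.strong_induction_on with
  | _ j ih =>
    intro hj
    rw [Finset.mem_Icc] at hj
    have hX : X j = Y j + ∑ q ∈ Finset.Ico 1 j, X q * (-2 * zetaBar (2 * j - 2 * q)) := by
      rw [h j (Finset.mem_Icc.2 hj), add_assoc, ← Finset.sum_add_distrib]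
      rw [Finset.sum_eq_zero, add_zero]
      intro q _
      ring
    have hsplit : ∑ i ∈ Finset.Icc 1 j, Y i * Z i j
        = ∑ i ∈ Finset.Ico 1 j, Y i * Z i j + Y j := by
      rw [← Finset.Ico_insert_right hj.1, Finset.sum_insert (by simp), Z_self, mul_one, add_comm]
    rw [hX, hsplit, add_comm]
    congr 1
    calc ∑ q ∈ Finset.Ico 1 j, X q * (-2 * zetaBar (2 * j - 2 * q))
        = ∑ q ∈ Finset.Ico 1 j, ∑ i ∈ Finset.Icc 1 q,
            Y i * (Z i q * (-2 * zetaBar (2 * j - 2 * q))) := by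
          refine Finset.sum_congr rfl fun q hq => ?_
          rw [Finset.mem_Ico] at hq
          rw [ih q hq.2 (Finset.mem_Icc.2 ⟨hq.1, hq.2.le.trans hj.2⟩), Finset.sum_mul]
          exact Finset.sum_congr rfl fun i _ => by ring
      _ = ∑ i ∈ Finset.Ico 1 j, ∑ q ∈ Finset.Ico i j,
            Y i * (Z i q * (-2 * zetaBar (2 * j - 2 * q))) := by
          -- After exchanging the sums over 1 ≤ i ≤ q < j, the inner sum over q is the recursion
          -- `Z_of_lt`.
          refine Finset.sum_comm' fun q i => ?_
          simp only [Finset.mem_Ico, Finset.mem_Icc]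
          omega
      _ = _ := by
          refine Finset.sum_congr rfl fun i hi => ?_
          rw [Finset.mem_Ico] at hi
          rw [Z_of_lt hi.2, Finset.mul_sum]

/-! ### Power series with coefficients of polynomial growth -/

/-- Sequences of at most polynomial growth. -/
def PolyBounded (a : ℕ → ℝ) : Prop :=
  ∃ (C : ℝ) (k : ℕ), ∀ n : ℕ, |a n| ≤ C * ((n : ℝ) + 1) ^ k

lemma summable_succ_pow_mul_geometric (k : ℕ) {ρ : ℝ} (h0 : 0 < ρ) (h1 : ρ < 1) :
    Summable fun n : ℕ => ((n : ℝ) + 1) ^ k * ρ ^ n := by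
  have h := (summable_nat_add_iff (f := fun n : ℕ => (n : ℝ) ^ k * ρ ^ n) 1).2
    (summable_pow_mul_geometric_of_norm_lt_one k
      (show ‖ρ‖ < 1 by rwa [Real.norm_eq_abs, abs_of_pos h0]))
  refine (h.mul_left ρ⁻¹).congr fun n => ?_
  push_cast
  rw [pow_succ ρ]
  field_simp

namespace PolyBounded

variable {a : ℕ → ℝ}

lemma summable_abs (ha : PolyBounded a) {z : ℝ} (hz : |z| < 1) :
    Summable fun n => |a n * z ^ n| := by
  obtain ⟨C, k, h⟩ := ha
  obtain ⟨ρ, h1, h2⟩ := exists_between hz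
  have hρ : 0 < ρ := (abs_nonneg z).trans_lt h1
  refine Summable.of_nonneg_of_le (fun n => abs_nonneg _) (fun n => ?_)
    ((summable_succ_pow_mul_geometric k hρ h2).mul_left C)
  rw [abs_mul, abs_pow, ← mul_assoc]
  exact mul_le_mul (h n) (pow_le_pow_left₀ (abs_nonneg z) h1.le n) (by positivity)
    ((abs_nonneg _).trans (h n))

lemma summable (ha : PolyBounded a) {z : ℝ} (hz : |z| < 1) : Summable fun n => a n * z ^ n :=
  (ha.summable_abs hz).of_abs

lemma alternate (ha : PolyBounded a) : PolyBounded fun n => (-1) ^ n * a n := by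
  obtain ⟨C, k, h⟩ := ha
  exact ⟨C, k, fun n => by simpa [abs_mul] using h n⟩

/-- The operator z d/dz multiplies the n-th coefficient by n; recording z D rather than D avoids
shifting indices. -/
lemma hasDerivAt (ha : PolyBounded a) {z : ℝ} (hz : |z| < 1) :
    ∃ D : ℝ, HasDerivAt (fun w => ∑' n, a n * w ^ n) D z ∧
      HasSum (fun n : ℕ => (n : ℝ) * (a n * z ^ n)) (z * D) := by
  obtain ⟨C, k, h⟩ := id ha
  obtain ⟨ρ, h1, h2⟩ := exists_between hz
  have hρ : 0 < ρ := (abs_nonneg z).trans_lt h1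
  have hu : Summable fun n : ℕ => ρ⁻¹ * (C * (((n : ℝ) + 1) ^ (k + 1) * ρ ^ n)) :=
    ((summable_succ_pow_mul_geometric (k + 1) hρ h2).mul_left C).mul_left _
  -- The factor ρ⁻¹ compensates for the exponent n - 1 against ρ^n.
  have hbound : ∀ (n : ℕ), ∀ y ∈ Set.Ioo (-ρ) ρ, ‖a n * ((n : ℝ) * y ^ (n - 1))‖
      ≤ ρ⁻¹ * (C * (((n : ℝ) + 1) ^ (k + 1) * ρ ^ n)) := by
    intro n y hy
    have hy' : |y| ≤ ρ := (abs_lt.2 hy).le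
    have hC : 0 ≤ C * ((n : ℝ) + 1) ^ k := (abs_nonneg _).trans (h n)
    cases n with
    | zero =>
      simp only [Nat.cast_zero, zero_mul, mul_zero, norm_zero]
      simp only [Nat.cast_zero, zero_add, one_pow, mul_one, pow_zero] at hC ⊢
      positivity
    | succ n =>
      rw [Nat.add_sub_cancel, Real.norm_eq_abs, abs_mul, abs_mul, abs_pow, Nat.abs_cast]
      have h3 : ρ⁻¹ * (C * ((((n + 1 : ℕ) : ℝ) + 1) ^ (k + 1) * ρ ^ (n + 1)))
          = C * (((n + 1 : ℕ) : ℝ) + 1) ^ k * ((((n + 1 : ℕ) : ℝ) + 1) * ρ ^ n) := by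
        rw [pow_succ ρ, pow_succ _ k]
        field_simp
      rw [h3]
      refine mul_le_mul (h _) ?_ (by positivity) hC
      exact mul_le_mul (by linarith) (pow_le_pow_left₀ (abs_nonneg y) hy' n) (by positivity)
        (by positivity)
  have hmem : z ∈ Set.Ioo (-ρ) ρ := abs_lt.1 h1
  refine ⟨∑' n, a n * ((n : ℝ) * z ^ (n - 1)),
    hasDerivAt_tsum_of_isPreconnected hu isOpen_Ioo isPreconnected_Ioo
      (fun n y _ => (hasDerivAt_pow n y).const_mul (a n)) hbound hmem (ha.summable hz) hmem, ?_⟩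
  have hs : Summable fun n => a n * ((n : ℝ) * z ^ (n - 1)) :=
    Summable.of_norm_bounded hu fun n => hbound n z hmem
  have hfun : (fun n : ℕ => (n : ℝ) * (a n * z ^ n))
      = fun n : ℕ => z * (a n * ((n : ℝ) * z ^ (n - 1))) := by
    funext n
    cases n with
    | zero => simp
    | succ n => rw [Nat.add_sub_cancel, pow_succ]; ring
  rw [hfun]
  exact hs.hasSum.mul_left z

end PolyBounded

lemma SlowlyVarying.polyBounded {u : ℕ → ℝ} (hu : SlowlyVarying u) : PolyBounded u :=
  hu.exists_le_pow

/-! ### Generating functions of chains -/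

/-- The power series `∑ (-1) ^ i chainCoeff r d i z ^ i`. -/
def coeffSeries (r d : ℕ) (z : ℝ) : ℝ := ∑' i, (-1) ^ i * chainCoeff r d i * z ^ i

/-- The power series `∑ (-1) ^ i chainSum r d i z ^ i`. -/
def sumSeries (r d : ℕ) (z : ℝ) : ℝ := ∑' i, (-1) ^ i * chainSum r d i * z ^ i

lemma polyBounded_coeff (r d : ℕ) : PolyBounded fun i => (-1) ^ i * chainCoeff r d i :=
  PolyBounded.alternate (exists_chainCoeff_le r d)

lemma polyBounded_sum (r d : ℕ) : PolyBounded fun i => (-1) ^ i * chainSum r d i :=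
  (slowlyVarying_chainSum r d).polyBounded.alternate

lemma hasSum_coeffSeries (r d : ℕ) {z : ℝ} (hz : |z| < 1) :
    HasSum (fun i => (-1) ^ i * chainCoeff r d i * z ^ i) (coeffSeries r d z) :=
  ((polyBounded_coeff r d).summable hz).hasSum

lemma hasSum_sumSeries (r d : ℕ) {z : ℝ} (hz : |z| < 1) :
    HasSum (fun i => (-1) ^ i * chainSum r d i * z ^ i) (sumSeries r d z) :=
  ((polyBounded_sum r d).summable hz).hasSum

lemma coeffSeries_zero_zero (z : ℝ) : coeffSeries 0 0 z = 1 := by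
  rw [coeffSeries, tsum_eq_single 0]
  · simp [chainCoeff_zero]
  · intro i hi
    simp [chainCoeff_zero, hi]

lemma coeffSeries_zero_succ (d : ℕ) (z : ℝ) : coeffSeries 0 (d + 1) z = 0 := by
  simp [coeffSeries, chainCoeff_zero]

/-- Taking partial sums divides a power series in -z by 1 - (-z). -/
lemma one_add_mul_sumSeries (r d : ℕ) {z : ℝ} (hz : |z| < 1) :
    (1 + z) * sumSeries r d z = coeffSeries r d z := by
  have h1 := hasSum_sumSeries r d hz
  have h2 := (hasSum_nat_add_iff' 1).2 h1
  have h3 := (hasSum_nat_add_iff' 1).2 (hasSum_coeffSeries r d hz)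
  have h4 := h2.add (h1.mul_left z)
  have h5 : (fun i => (-1) ^ (i + 1) * chainSum r d (i + 1) * z ^ (i + 1)
      + z * ((-1) ^ i * chainSum r d i * z ^ i))
      = fun i => (-1) ^ (i + 1) * chainCoeff r d (i + 1) * z ^ (i + 1) := by
    funext i
    rw [chainSum_succ_index]
    ring
  rw [h5] at h4
  have h6 := h4.unique h3
  simp only [Finset.sum_range_one, chainSum_zero_index, pow_zero, mul_one, one_mul] at h6
  linarith

lemma coeff_recursion (r d i : ℕ) :
    ((r : ℝ) + 1 + 2 * i) * chainCoeff (r + 1) d i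
      = 2 * chainSum r d i + if d = 0 then 0 else chainCoeff (r + 1) (d - 1) i := by
  have h : (r : ℝ) + 1 + 2 * i ≠ 0 := by positivity
  cases d with
  | zero => rw [chainCoeff_succ_zero, mul_div_cancel₀ _ h]; simp
  | succ d => rw [chainCoeff_succ_succ, mul_div_cancel₀ _ h]; simp

/-- The operator r + 1 + 2 z d/dz multiplies the i-th coefficient by r + 1 + 2i, clearing the
denominator in the recursion. -/
lemma exists_hasDerivAt_coeffSeries (r d : ℕ) {z : ℝ} (hz : |z| < 1) :
    ∃ D : ℝ, HasDerivAt (coeffSeries (r + 1) d) D z ∧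
      ((r : ℝ) + 1) * coeffSeries (r + 1) d z + 2 * (z * D)
        = 2 * sumSeries r d z + if d = 0 then 0 else coeffSeries (r + 1) (d - 1) z := by
  obtain ⟨D, hD, hs⟩ := (polyBounded_coeff (r + 1) d).hasDerivAt hz
  refine ⟨D, hD, ?_⟩
  have h1 := ((hasSum_coeffSeries (r + 1) d hz).mul_left ((r : ℝ) + 1)).add (hs.mul_left 2)
  have h2 : HasSum (fun i => if d = 0 then 0 else (-1) ^ i * chainCoeff (r + 1) (d - 1) i * z ^ i)
      (if d = 0 then 0 else coeffSeries (r + 1) (d - 1) z) := by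
    split_ifs
    · exact hasSum_zero
    · exact hasSum_coeffSeries _ _ hz
  have h3 := ((hasSum_sumSeries r d hz).mul_left 2).add h2
  refine h1.unique ?_
  convert h3 using 2 with i
  have h4 := coeff_recursion r d i
  split_ifs at h4 ⊢
  · linear_combination (-1) ^ i * z ^ i * h4
  · linear_combination (-1) ^ i * z ^ i * h4

/-- The generating function `∑ (-1) ^ i chainCoeff r d i u ^ (r + 2 i)`. -/
def chainGen (r d : ℕ) (u : ℝ) : ℝ := u ^ r * coeffSeries r d (u ^ 2)

lemma sq_abs_lt_one {u : ℝ} (hu : |u| < 1) : |u ^ 2| < 1 := by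
  rw [abs_pow]
  exact pow_lt_one₀ (abs_nonneg u) hu two_ne_zero

/-- Differentiating u^(r+1+2i) lowers the last exponent by one. Either it stays positive, which is
the form du/u, or the variable disappears and the depth drops, which is the form 2 du/(1 + u²). The
first contribution is written without dividing by u, so that u = 0 is allowed. -/
lemma hasDerivAt_chainGen_aux (r d : ℕ) {u : ℝ} (hu : |u| < 1) :
    HasDerivAt (chainGen (r + 1) d)
      (2 / (1 + u ^ 2) * chainGen r d u
        + u ^ r * if d = 0 then 0 else coeffSeries (r + 1) (d - 1) (u ^ 2)) u := by
  have hz := sq_abs_lt_one hu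
  obtain ⟨D, hD, hrec⟩ := exists_hasDerivAt_coeffSeries r d hz
  have h1 : HasDerivAt (fun u : ℝ => coeffSeries (r + 1) d (u ^ 2)) (D * (2 * u)) u := by
    have := HasDerivAt.comp (h := fun u : ℝ => u ^ 2) u hD (hasDerivAt_pow 2 u)
    simpa [Function.comp_def] using this
  have h2 := (hasDerivAt_pow (r + 1) u).mul h1
  refine h2.congr_deriv ?_
  have h3 := one_add_mul_sumSeries r d hz
  have h4 : 1 + u ^ 2 ≠ 0 := by positivity
  have h5 : 2 / (1 + u ^ 2) * chainGen r d u = u ^ r * (2 * sumSeries r d (u ^ 2)) := by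
    rw [chainGen, ← h3]
    field_simp
  rw [h5, ← mul_add, ← hrec]
  push_cast
  rw [pow_succ u r]
  ring

lemma hasDerivAt_chainGen_zero (r : ℕ) {u : ℝ} (hu : |u| < 1) :
    HasDerivAt (chainGen (r + 1) 0) (2 / (1 + u ^ 2) * chainGen r 0 u) u := by
  simpa using hasDerivAt_chainGen_aux r 0 hu

lemma hasDerivAt_chainGen_succ (r d : ℕ) {u : ℝ} (hu : |u| < 1) (h0 : u ≠ 0) :
    HasDerivAt (chainGen (r + 1) (d + 1))
      (2 / (1 + u ^ 2) * chainGen r (d + 1) u + chainGen (r + 1) d u / u) u := by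
  refine (hasDerivAt_chainGen_aux r (d + 1) hu).congr_deriv ?_
  rw [if_neg (Nat.succ_ne_zero d), Nat.add_sub_cancel, chainGen, chainGen, pow_succ u r]
  field_simp

lemma chainGen_zero_left (d : ℕ) (u : ℝ) : chainGen 0 d u = if d = 0 then 1 else 0 := by
  cases d with
  | zero => simp [chainGen, coeffSeries_zero_zero]
  | succ d => simp [chainGen, coeffSeries_zero_succ]

/-- For d = 0 only the form 2 du/(1 + u²) = d(2 arctan u) occurs, and iterating a single form gives
divided powers. -/
lemma chainGen_eq_arctan (r : ℕ) {u : ℝ} (hu : |u| < 1) :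
    chainGen r 0 u = (2 * Real.arctan u) ^ r / r.factorial := by
  induction r generalizing u with
  | zero => simp [chainGen_zero_left]
  | succ r ih =>
    have hd : ∀ v ∈ Set.Ioo (-1 : ℝ) 1, HasDerivAt
        (fun v => chainGen (r + 1) 0 v - (2 * Real.arctan v) ^ (r + 1) / (r + 1).factorial) 0 v := by
      intro v hv
      have hv' := abs_lt.2 hv
      have h1 := ((((Real.hasDerivAt_arctan v).const_mul 2).pow (r + 1)).div_const
        ((r + 1).factorial : ℝ))
      refine ((hasDerivAt_chainGen_zero r hv').sub h1).congr_deriv ?_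
      rw [ih hv', Nat.add_sub_cancel, Nat.factorial_succ]
      have := Nat.factorial_ne_zero r
      push_cast
      field_simp
      ring
    have h0 : (0 : ℝ) ∈ Set.Ioo (-1 : ℝ) 1 := by norm_num
    have h1 := isOpen_Ioo.is_const_of_deriv_eq_zero isPreconnected_Ioo
      (fun v hv => (hd v hv).differentiableAt.differentiableWithinAt)
      (fun v hv => (hd v hv).deriv) (abs_lt.1 hu) h0
    have h2 : chainGen (r + 1) 0 0 = 0 := by simp [chainGen]
    simp only [h2, Real.arctan_zero, mul_zero, zero_pow (Nat.succ_ne_zero r), zero_div,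
      sub_self] at h1
    linarith

/-! ### Telescoping sums of divided powers -/

/-- `∑ B ^ j / j! f_{D - j}` over `0 ≤ j ≤ D`. -/
def divSum (B : ℝ → ℝ) (f : ℕ → ℝ → ℝ) (D : ℕ) (t : ℝ) : ℝ :=
  ∑ j ∈ Finset.range (D + 1), B t ^ j / (j.factorial : ℝ) * f (D - j) t

lemma hasDerivAt_divPow {B : ℝ → ℝ} {b t : ℝ} (hB : HasDerivAt B b t) (j : ℕ) :
    HasDerivAt (fun t => B t ^ (j + 1) / ((j + 1).factorial : ℝ))
      (b * (B t ^ j / (j.factorial : ℝ))) t := by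
  refine ((hB.pow (j + 1)).div_const _).congr_deriv ?_
  have := Nat.factorial_ne_zero j
  rw [Nat.factorial_succ, Nat.add_sub_cancel]
  push_cast
  field_simp

/-- Repeated integration by parts in closed form: the derivative of each divided power cancels the
-b f_j part coming from the neighbouring summand, and only the X terms survive. -/
lemma hasDerivAt_divSum {B : ℝ → ℝ} {f : ℕ → ℝ → ℝ} {X : ℕ → ℝ} {b t : ℝ}
    (hB : HasDerivAt B b t) (h0 : HasDerivAt (f 0) (X 0) t)
    (hs : ∀ j, HasDerivAt (f (j + 1)) (-b * f j t + X (j + 1)) t) (D : ℕ) :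
    HasDerivAt (divSum B f D)
      (∑ j ∈ Finset.range (D + 1), B t ^ j / (j.factorial : ℝ) * X (D - j)) t := by
  have hp : ∀ j, HasDerivAt (fun t => B t ^ j / (j.factorial : ℝ))
      (if j = 0 then 0 else b * (B t ^ (j - 1) / ((j - 1).factorial : ℝ))) t := by
    intro j
    cases j with
    | zero => simpa using hasDerivAt_const t (1 : ℝ)
    | succ j => simpa using hasDerivAt_divPow hB j
  have hf : ∀ j, HasDerivAt (f j) ((if j = 0 then 0 else -b * f (j - 1) t) + X j) t := by
    intro j
    cases j with
    | zero => simpa using h0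
    | succ j => simpa using hs j
  have hsum := HasDerivAt.fun_sum (u := Finset.range (D + 1))
    fun j _ => (hp j).mul (hf (D - j))
  refine hsum.congr_deriv ?_
  have h1 : ∑ j ∈ Finset.range (D + 1),
      (if j = 0 then 0 else b * (B t ^ (j - 1) / ((j - 1).factorial : ℝ))) * f (D - j) t
      = ∑ j ∈ Finset.range D, b * (B t ^ j / (j.factorial : ℝ)) * f (D - (j + 1)) t := by
    rw [Finset.sum_range_succ']
    simp
  have h2 : ∑ j ∈ Finset.range (D + 1),
      B t ^ j / (j.factorial : ℝ) * (if D - j = 0 then 0 else -b * f (D - j - 1) t)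
      = ∑ j ∈ Finset.range D, B t ^ j / (j.factorial : ℝ) * (-b * f (D - (j + 1)) t) := by
    rw [Finset.sum_range_succ]
    simp only [Nat.sub_self, if_true, mul_zero, add_zero]
    refine Finset.sum_congr rfl fun j hj => ?_
    rw [Finset.mem_range] at hj
    rw [if_neg (by omega), Nat.sub_sub]
  simp only [mul_add, Finset.sum_add_distrib]
  rw [h1, h2, ← add_assoc, ← Finset.sum_add_distrib, Finset.sum_eq_zero, zero_add]
  intro j _
  ring

lemma tendsto_divSum {B : ℝ → ℝ} {f : ℕ → ℝ → ℝ} {ℓ : ℕ → ℝ} {l : Filter ℝ}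
    (hB : Tendsto B l (𝓝 0)) (hf : ∀ j, Tendsto (f j) l (𝓝 (ℓ j))) (D : ℕ) :
    Tendsto (divSum B f D) l (𝓝 (ℓ D)) := by
  have h : Tendsto (divSum B f D) l (𝓝 (∑ j ∈ Finset.range (D + 1),
      (0 : ℝ) ^ j / (j.factorial : ℝ) * ℓ (D - j))) :=
    tendsto_finsetSum _ fun j _ => ((hB.pow j).div_const _).mul (hf (D - j))
  rw [Finset.sum_range_succ'] at h
  simpa using h

/-- Stated through products because B may be unbounded: `logRatio` tends to infinity at 1. -/
lemma tendsto_divSum_zero {B : ℝ → ℝ} {f : ℕ → ℝ → ℝ} {l : Filter ℝ}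
    (hf : ∀ i j, Tendsto (fun t => B t ^ i * f j t) l (𝓝 0)) (D : ℕ) :
    Tendsto (divSum B f D) l (𝓝 0) := by
  have h : Tendsto (divSum B f D) l (𝓝 (∑ j ∈ Finset.range (D + 1),
      1 / (j.factorial : ℝ) * 0)) := by
    refine tendsto_finsetSum _ fun j _ => ?_
    refine ((hf j (D - j)).const_mul (1 / (j.factorial : ℝ))).congr fun t => ?_
    ring
  simpa using h

/-! ### The substitution `s = (1 - t) / (1 + t)` -/

/-- The involution `t ↦ (1 - t) / (1 + t)` of `(0, 1)`. -/
def cayley (t : ℝ) : ℝ := (1 - t) / (1 + t)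

/-- `log ((1 + t) / (1 - t))`. -/
def logRatio (t : ℝ) : ℝ := -Real.log (cayley t)

lemma cayley_mem {t : ℝ} (ht : t ∈ Set.Ioo (0 : ℝ) 1) : cayley t ∈ Set.Ioo (0 : ℝ) 1 := by
  obtain ⟨h0, h1⟩ := ht
  have : 0 < 1 + t := by linarith
  exact ⟨div_pos (by linarith) this, (div_lt_one this).2 (by linarith)⟩

lemma logRatio_nonneg {t : ℝ} (ht : t ∈ Set.Ioo (0 : ℝ) 1) : 0 ≤ logRatio t :=
  neg_nonneg.2 (Real.log_nonpos (cayley_mem ht).1.le (cayley_mem ht).2.le)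

lemma hasDerivAt_cayley {t : ℝ} (ht : t ∈ Set.Ioo (0 : ℝ) 1) :
    HasDerivAt cayley (-2 / (1 + t) ^ 2) t := by
  have h : 1 + t ≠ 0 := by linarith [ht.1]
  refine (((hasDerivAt_id t).const_sub 1).div ((hasDerivAt_id t).const_add 1) h).congr_deriv ?_
  simp only [id]
  field_simp
  ring

lemma hasDerivAt_logRatio {t : ℝ} (ht : t ∈ Set.Ioo (0 : ℝ) 1) :
    HasDerivAt logRatio (2 / (1 - t ^ 2)) t := by
  have h1 := (cayley_mem ht).1
  refine ((hasDerivAt_cayley ht).log h1.ne').neg.congr_deriv ?_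
  have h2 : 1 + t ≠ 0 := by linarith [ht.1]
  have h3 : 1 - t ≠ 0 := by linarith [ht.2]
  have h4 : 1 - t ^ 2 ≠ 0 := by
    rw [show 1 - t ^ 2 = (1 + t) * (1 - t) by ring]; exact mul_ne_zero h2 h3
  rw [cayley]
  field_simp
  ring

lemma continuousAt_cayley {t : ℝ} (ht : 1 + t ≠ 0) : ContinuousAt cayley t := by
  unfold cayley
  fun_prop (disch := assumption)

lemma tendsto_cayley_zero : Tendsto cayley (𝓝[>] 0) (𝓝[<] 1) := by
  refine tendsto_nhdsWithin_iff.2 ⟨?_, ?_⟩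
  · have : Tendsto cayley (𝓝 0) (𝓝 (cayley 0)) := continuousAt_cayley (by norm_num)
    simpa [cayley] using this.mono_left nhdsWithin_le_nhds
  · filter_upwards [Ioo_mem_nhdsGT (zero_lt_one' ℝ)] with t ht using (cayley_mem ht).2

lemma tendsto_cayley_one : Tendsto cayley (𝓝[<] 1) (𝓝[>] 0) := by
  refine tendsto_nhdsWithin_iff.2 ⟨?_, ?_⟩
  · have : Tendsto cayley (𝓝 1) (𝓝 (cayley 1)) := continuousAt_cayley (by norm_num)
    simpa [cayley] using this.mono_left nhdsWithin_le_nhds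
  · filter_upwards [Ioo_mem_nhdsLT (zero_lt_one' ℝ)] with t ht using (cayley_mem ht).1

lemma tendsto_logRatio_zero : Tendsto logRatio (𝓝[>] 0) (𝓝 0) := by
  have h : Tendsto (fun s : ℝ => -Real.log s) (𝓝 1) (𝓝 (-Real.log 1)) :=
    (Real.continuousAt_log one_ne_zero).neg
  rw [Real.log_one, neg_zero] at h
  exact h.comp (tendsto_cayley_zero.mono_right nhdsWithin_le_nhds)

lemma tendsto_logRatio_one : Tendsto logRatio (𝓝[<] 1) atTop :=
  tendsto_neg_atBot_atTop.comp (Real.tendsto_log_nhdsGT_zero.comp tendsto_cayley_one)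

/-- Since `cayley` = exp(-`logRatio`), the exponential beats every power. -/
lemma tendsto_logRatio_pow_mul_cayley (j : ℕ) :
    Tendsto (fun t => logRatio t ^ j * cayley t) (𝓝[<] 1) (𝓝 0) := by
  refine ((Real.tendsto_pow_mul_exp_neg_atTop_nhds_zero j).comp tendsto_logRatio_one).congr' ?_
  filter_upwards [Ioo_mem_nhdsLT (zero_lt_one' ℝ)] with t ht
  simp only [Function.comp_apply]
  rw [logRatio, neg_neg, Real.exp_log (cayley_mem ht).1]

/-- The bound x^d/d! ≤ e^x is applied at half of `logRatio`: the full value would give the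
non-integrable 1/(1 - t), half of it gives the integrable (1 - t)^(-1/2). -/
lemma logRatio_pow_le (d : ℕ) {t : ℝ} (ht : t ∈ Set.Ioo (0 : ℝ) 1) :
    logRatio t ^ d / (d.factorial : ℝ) ≤ 2 ^ d * (2 ^ (1 / 2 : ℝ) * (1 - t) ^ (-(1 / 2) : ℝ)) := by
  have h0 := logRatio_nonneg ht
  have hs := (cayley_mem ht).1
  have h1 := Real.pow_div_factorial_le_exp (logRatio t / 2) (by positivity) d
  have h2 : Real.exp (logRatio t / 2) = cayley t ^ (-(1 / 2) : ℝ) := by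
    rw [Real.rpow_def_of_pos hs, logRatio]
    congr 1
    ring
  have h3 : cayley t ^ (-(1 / 2) : ℝ) ≤ ((1 - t) / 2) ^ (-(1 / 2) : ℝ) := by
    refine Real.rpow_le_rpow_of_nonpos (by linarith [ht.2]) ?_ (by norm_num)
    exact div_le_div_of_nonneg_left (by linarith [ht.2]) (by linarith [ht.1]) (by linarith [ht.2])
  have h4 : ((1 - t) / 2) ^ (-(1 / 2) : ℝ) = 2 ^ (1 / 2 : ℝ) * (1 - t) ^ (-(1 / 2) : ℝ) := by
    rw [Real.div_rpow (by linarith [ht.2]) (by norm_num), Real.rpow_neg (by norm_num : (0 : ℝ) ≤ 2)]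
    field_simp
  calc logRatio t ^ d / (d.factorial : ℝ) = 2 ^ d * ((logRatio t / 2) ^ d / (d.factorial : ℝ)) := by
        rw [div_pow]; field_simp
    _ ≤ 2 ^ d * (2 ^ (1 / 2 : ℝ) * (1 - t) ^ (-(1 / 2) : ℝ)) := by
        refine mul_le_mul_of_nonneg_left ?_ (by positivity)
        rw [← h4]
        exact h1.trans (h2.le.trans h3)

lemma measurable_logRatio : Measurable logRatio := by
  unfold logRatio cayley
  fun_prop

lemma ae_mem_Ioo_of_uIoc {P : ℝ → Prop} (h : ∀ t ∈ Set.Ioo (0 : ℝ) 1, P t) :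
    ∀ᵐ t ∂(MeasureTheory.volume : MeasureTheory.Measure ℝ), t ∈ Set.uIoc (0 : ℝ) 1 → P t := by
  have h1 : ∀ᵐ t ∂(MeasureTheory.volume : MeasureTheory.Measure ℝ), t ≠ 1 := by
    simp [MeasureTheory.ae_iff]
  filter_upwards [h1] with t ht htm
  rw [Set.uIoc_of_le zero_le_one] at htm
  exact h t ⟨htm.1, lt_of_le_of_ne htm.2 ht⟩

lemma intervalIntegrable_of_bound {f g : ℝ → ℝ} (hf : Measurable f)
    (hg : IntervalIntegrable g MeasureTheory.volume 0 1)
    (h : ∀ t ∈ Set.Ioo (0 : ℝ) 1, |f t| ≤ g t) :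
    IntervalIntegrable f MeasureTheory.volume 0 1 := by
  refine hg.mono_fun' hf.aestronglyMeasurable ?_
  exact (MeasureTheory.ae_restrict_iff' measurableSet_uIoc).2 (ae_mem_Ioo_of_uIoc h)

lemma intervalIntegrable_logRatio_pow (d : ℕ) :
    IntervalIntegrable (fun t => logRatio t ^ d / (d.factorial : ℝ)) MeasureTheory.volume 0 1 := by
  have h1 : IntervalIntegrable (fun t : ℝ => (1 - t) ^ (-(1 / 2) : ℝ)) MeasureTheory.volume 0 1 := by
    have := (intervalIntegral.intervalIntegrable_rpow' (a := 1) (b := 0) (r := -(1 / 2))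
      (by norm_num)).comp_sub_left 1
    simpa using this
  refine intervalIntegrable_of_bound ((measurable_logRatio.pow_const d).div_const _)
    ((h1.const_mul (2 ^ (1 / 2 : ℝ))).const_mul (2 ^ d)) fun t ht => ?_
  have h0 := logRatio_nonneg ht
  rw [abs_of_nonneg (by positivity)]
  exact logRatio_pow_le d ht

/-! ### Integral representations -/

/-- Abel's theorem, since `cayley` tends to 1 from below as t → 0⁺. -/
lemma tendsto_coeffSeries {r d : ℕ} {L : ℝ}
    (hL : Tendsto (fun N => ∑ i ∈ Finset.range N, (-1 : ℝ) ^ i * chainCoeff r d i) atTop (𝓝 L)) :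
    Tendsto (fun t => chainGen r d (cayley t)) (𝓝[>] 0) (𝓝 L) := by
  have h1 : Tendsto (coeffSeries r d) (𝓝[<] 1) (𝓝 L) := Real.tendsto_tsum_powerSeries_nhdsWithin_lt hL
  have h2 : Tendsto (fun t => cayley t ^ 2) (𝓝[>] 0) (𝓝[<] 1) := by
    refine tendsto_nhdsWithin_iff.2 ⟨?_, ?_⟩
    · simpa using (tendsto_cayley_zero.mono_right nhdsWithin_le_nhds).pow 2
    · filter_upwards [Ioo_mem_nhdsGT (zero_lt_one' ℝ)] with t ht
      exact pow_lt_one₀ (cayley_mem ht).1.le (cayley_mem ht).2 two_ne_zero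
  have h3 : Tendsto (fun t => cayley t ^ r) (𝓝[>] 0) (𝓝 1) := by
    simpa using (tendsto_cayley_zero.mono_right nhdsWithin_le_nhds).pow r
  simpa [chainGen] using h3.mul (h1.comp h2)

lemma tendsto_logRatio_pow_mul_chainGen (i r d : ℕ) :
    Tendsto (fun t => logRatio t ^ i * chainGen (r + 1) d (cayley t)) (𝓝[<] 1) (𝓝 0) := by
  have h1 : ContinuousAt (coeffSeries (r + 1) d) 0 :=
    (exists_hasDerivAt_coeffSeries r d (by simp)).choose_spec.1.continuousAt
  have h2 : Tendsto (fun u : ℝ => u ^ r * coeffSeries (r + 1) d (u ^ 2)) (𝓝 0)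
      (𝓝 (0 ^ r * coeffSeries (r + 1) d 0)) := by
    refine ((continuous_pow r).tendsto 0).mul (h1.tendsto.comp ?_)
    simpa using (continuous_pow 2).tendsto (0 : ℝ)
  have h3 := (tendsto_logRatio_pow_mul_cayley i).mul
    (h2.comp (tendsto_cayley_one.mono_right nhdsWithin_le_nhds))
  rw [zero_mul] at h3
  refine h3.congr fun t => ?_
  simp only [Function.comp_apply, chainGen]
  rw [pow_succ (cayley t) r]
  ring

lemma hasDerivAt_two_arctan (t : ℝ) :
    HasDerivAt (fun t => 2 * Real.arctan t) (2 / (1 + t ^ 2)) t :=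
  ((Real.hasDerivAt_arctan t).const_mul 2).congr_deriv (by ring)

/-- The form 2 du/(1 + u²) only changes sign, because arctan u + arctan t = π/4 on (0, 1). -/
lemma cayley_jacobian {t : ℝ} (ht : t ∈ Set.Ioo (0 : ℝ) 1) :
    2 / (1 + cayley t ^ 2) * (-2 / (1 + t) ^ 2) = -(2 / (1 + t ^ 2)) := by
  have h2 : 1 + t ≠ 0 := by linarith [ht.1]
  have h3 : 1 + t ^ 2 ≠ 0 := by positivity
  have h4 : (1 + t) ^ 2 + (1 - t) ^ 2 ≠ 0 := by
    rw [show (1 + t) ^ 2 + (1 - t) ^ 2 = 2 * (1 + t ^ 2) by ring]; positivity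
  rw [cayley, div_pow]
  field_simp
  ring

lemma cayley_logDeriv {t : ℝ} (ht : t ∈ Set.Ioo (0 : ℝ) 1) :
    (cayley t)⁻¹ * (-2 / (1 + t) ^ 2) = -(2 / (1 - t ^ 2)) := by
  have h2 : 1 + t ≠ 0 := by linarith [ht.1]
  have h3 : 1 - t ≠ 0 := by linarith [ht.2]
  have h4 : 1 - t ^ 2 ≠ 0 := by
    rw [show 1 - t ^ 2 = (1 + t) * (1 - t) by ring]; exact mul_ne_zero h2 h3
  rw [cayley]
  field_simp
  ring

/-- Divided powers of `logRatio` absorb all occurrences of the form du/u, leaving only the drop in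
depth. -/
lemma hasDerivAt_divSum_chainGen (r D : ℕ) {t : ℝ} (ht : t ∈ Set.Ioo (0 : ℝ) 1) :
    HasDerivAt (divSum logRatio (fun d t => chainGen (r + 1) d (cayley t)) D)
      (-(2 / (1 + t ^ 2)) * divSum logRatio (fun d t => chainGen r d (cayley t)) D t) t := by
  have hs := cayley_mem ht
  have habs : |cayley t| < 1 := by rw [abs_of_pos hs.1]; exact hs.2
  have hc := hasDerivAt_cayley ht
  refine (hasDerivAt_divSum (X := fun d => -(2 / (1 + t ^ 2)) * chainGen r d (cayley t))
    (hasDerivAt_logRatio ht) ?_ ?_ D).congr_deriv ?_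
  · refine (HasDerivAt.comp t (hasDerivAt_chainGen_zero r habs) hc).congr_deriv ?_
    rw [← cayley_jacobian ht]
    ring
  · intro j
    refine (HasDerivAt.comp t (hasDerivAt_chainGen_succ r j habs hs.1.ne') hc).congr_deriv ?_
    rw [← cayley_jacobian ht, ← cayley_logDeriv ht]
    ring
  · rw [divSum, Finset.mul_sum]
    exact Finset.sum_congr rfl fun j _ => by ring

/-- A second telescoping, with divided powers of 2 arctan t, absorbs the drops in depth. Only depth
0 with d = 0 survives, so this is an explicit antiderivative of minus the integrand below. -/
lemma hasDerivAt_double_divSum (r D : ℕ) {t : ℝ} (ht : t ∈ Set.Ioo (0 : ℝ) 1) :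
    HasDerivAt (divSum (fun t => 2 * Real.arctan t)
        (fun i => divSum logRatio (fun d t => chainGen (i + 1) d (cayley t)) D) r)
      (-((2 * Real.arctan t) ^ r / (r.factorial : ℝ) * (2 / (1 + t ^ 2))
        * (logRatio t ^ D / (D.factorial : ℝ)))) t := by
  refine (hasDerivAt_divSum
    (X := fun i => if i = 0 then -(2 / (1 + t ^ 2)) * (logRatio t ^ D / (D.factorial : ℝ)) else 0)
    (hasDerivAt_two_arctan t) ?_ ?_ r).congr_deriv ?_
  · refine (hasDerivAt_divSum_chainGen 0 D ht).congr_deriv ?_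
    rw [if_pos rfl, divSum, Finset.sum_range_succ, Finset.sum_eq_zero, zero_add, Nat.sub_self]
    · simp [chainGen_zero_left]
    · intro j hj
      rw [Finset.mem_range] at hj
      simp only [chainGen_zero_left]
      rw [if_neg (by omega), mul_zero]
  · intro j
    refine (hasDerivAt_divSum_chainGen (j + 1) D ht).congr_deriv ?_
    simp
  · rw [Finset.sum_range_succ, Finset.sum_eq_zero, zero_add, Nat.sub_self, if_pos rfl]
    · ring
    · intro j hj
      rw [Finset.mem_range] at hj
      rw [if_neg (by omega), mul_zero]

lemma arctan_le_one_of_mem {t : ℝ} (h0 : 0 ≤ t) (h1 : t ≤ 1) :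
    0 ≤ Real.arctan t ∧ Real.arctan t ≤ 1 := by
  refine ⟨by simpa using Real.arctan_strictMono.monotone h0, ?_⟩
  have h2 := Real.arctan_strictMono.monotone h1
  rw [Real.arctan_one] at h2
  linarith [Real.pi_lt_four]

lemma arctan_kernel_bound (r : ℕ) {t : ℝ} (h0 : 0 ≤ t) (h1 : t ≤ 1) :
    |(2 * Real.arctan t) ^ r / (r.factorial : ℝ) * (2 / (1 + t ^ 2))| ≤ 2 ^ r * 2 := by
  obtain ⟨h2, h3⟩ := arctan_le_one_of_mem h0 h1
  rw [abs_of_nonneg (by positivity)]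
  refine mul_le_mul ?_ ?_ (by positivity) (by positivity)
  · refine (div_le_self (by positivity) ?_).trans
      (pow_le_pow_left₀ (by positivity) (by linarith) r)
    exact_mod_cast Nat.one_le_iff_ne_zero.2 (Nat.factorial_ne_zero r)
  · exact div_le_self (by norm_num) (by nlinarith)

lemma integral_arctan_pow_mul_logRatio_pow {r D : ℕ} {L : ℝ}
    (hL : Tendsto (fun N => ∑ i ∈ Finset.range N, (-1 : ℝ) ^ i * chainCoeff (r + 1) D i)
      atTop (𝓝 L)) :
    ∫ t in (0 : ℝ)..1, (2 * Real.arctan t) ^ r / (r.factorial : ℝ) * (2 / (1 + t ^ 2))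
        * (logRatio t ^ D / (D.factorial : ℝ)) = L := by
  have hint : IntervalIntegrable (fun t => (2 * Real.arctan t) ^ r / (r.factorial : ℝ)
      * (2 / (1 + t ^ 2)) * (logRatio t ^ D / (D.factorial : ℝ))) MeasureTheory.volume 0 1 := by
    refine intervalIntegrable_of_bound ?_
      ((intervalIntegrable_logRatio_pow D).const_mul (2 ^ r * 2)) fun t ht => ?_
    · have := measurable_logRatio
      fun_prop
    · have h0 := logRatio_nonneg ht
      rw [abs_mul, abs_of_nonneg (a := logRatio t ^ D / (D.factorial : ℝ)) (by positivity)]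
      exact mul_le_mul_of_nonneg_right (arctan_kernel_bound r ht.1.le ht.2.le) (by positivity)
  have hA0 : Tendsto (fun t => 2 * Real.arctan t) (𝓝[>] 0) (𝓝 0) := by
    have : ContinuousAt (fun t => 2 * Real.arctan t) 0 := by fun_prop
    simpa using this.tendsto.mono_left nhdsWithin_le_nhds
  have hA1 : Tendsto (fun t => 2 * Real.arctan t) (𝓝[<] 1) (𝓝 (2 * Real.arctan 1)) := by
    have : ContinuousAt (fun t => 2 * Real.arctan t) 1 := by fun_prop
    exact this.tendsto.mono_left nhdsWithin_le_nhds
  -- At t = 0 both outer functions vanish, so only the limit for (r, D) survives; limits for all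
  -- lower pairs are needed to know that their terms disappear.
  choose ℓ hℓ using exists_tendsto_chainCoeff
  have hlim0 := tendsto_divSum hA0
    (fun i => tendsto_divSum tendsto_logRatio_zero (fun d => tendsto_coeffSeries (hℓ i d)) D) r
  have hlim1 : Tendsto (divSum (fun t => 2 * Real.arctan t)
      (fun i => divSum logRatio (fun d t => chainGen (i + 1) d (cayley t)) D) r) (𝓝[<] 1)
      (𝓝 0) := by
    refine tendsto_divSum_zero (fun i j => ?_) r
    simpa using (hA1.pow i).mul
      (tendsto_divSum_zero (fun i d => tendsto_logRatio_pow_mul_chainGen i j d) D)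
  have h := intervalIntegral.integral_eq_sub_of_hasDerivAt_of_tendsto zero_lt_one
    (fun t ht => hasDerivAt_double_divSum r D ht) hint.neg hlim0 hlim1
  rw [intervalIntegral.integral_neg, zero_sub, neg_inj] at h
  rw [h]
  exact tendsto_nhds_unique (hℓ r D) hL

/-! ### Alternating zeta values as integrals -/

lemma exists_tendsto_zeta_coeff (k : ℕ) : ∃ L : ℝ, Tendsto
    (fun N => ∑ n ∈ Finset.range N, (-1 : ℝ) ^ n * (1 / ((n : ℝ) + 1) ^ (k + 1))) atTop (𝓝 L) := by
  have hu : SlowlyVarying fun n => 2 * (2 * (1 / (2 + 2 * (n : ℝ)))) ^ k :=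
    (((SlowlyVarying.inv_linear one_le_two).const_mul 2).pow k).const_mul 2
  obtain ⟨L, hL⟩ := hu.exists_tendsto one_le_two
  refine ⟨L, hL.congr fun N => Finset.sum_congr rfl fun n _ => ?_⟩
  have h : 2 * (1 / (2 + 2 * (n : ℝ))) = 1 / ((n : ℝ) + 1) := by
    field_simp
    ring
  have h' : (2 : ℝ) + 2 * n = 2 * ((n : ℝ) + 1) := by ring
  rw [h, h', pow_succ, one_div, one_div, inv_pow]
  field_simp

lemma zetaBarTrunc_eq (k N : ℕ) : zetaBarTrunc k N
    = ∑ n ∈ Finset.range N, (-1 : ℝ) ^ n * (1 / ((n : ℝ) + 1) ^ k) := by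
  rw [zetaBarTrunc, sum_Icc_eq_sum_range]
  refine Finset.sum_congr rfl fun n _ => ?_
  rw [Nat.add_sub_cancel, mul_one_div]
  push_cast
  rfl

lemma exists_tendsto_zetaBarTrunc {k : ℕ} (hk : 0 < k) :
    ∃ L : ℝ, Tendsto (zetaBarTrunc k) atTop (𝓝 L) := by
  obtain ⟨k, rfl⟩ : ∃ k', k = k' + 1 := ⟨k - 1, by omega⟩
  obtain ⟨L, hL⟩ := exists_tendsto_zeta_coeff k
  exact ⟨L, hL.congr fun N => (zetaBarTrunc_eq _ _).symm⟩

lemma tendsto_zetaBarTrunc {k : ℕ} (hk : 0 < k) :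
    Tendsto (zetaBarTrunc k) atTop (𝓝 (zetaBar k)) := by
  rw [zetaBar, if_neg hk.ne']
  exact tendsto_nhds_limUnder (exists_tendsto_zetaBarTrunc hk)

/-- The power series `∑ (-1) ^ n z ^ n / (n + 1) ^ k`. -/
def etaSeries (k : ℕ) (z : ℝ) : ℝ := ∑' n : ℕ, (-1) ^ n * (1 / ((n : ℝ) + 1) ^ k) * z ^ n

lemma polyBounded_eta (k : ℕ) : PolyBounded fun n => (-1) ^ n * (1 / ((n : ℝ) + 1) ^ k) := by
  refine PolyBounded.alternate ⟨1, 0, fun n => ?_⟩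
  rw [abs_of_nonneg (by positivity), pow_zero, mul_one]
  refine div_le_one_of_le₀ (one_le_pow₀ ?_) (by positivity)
  linarith [Nat.cast_nonneg (α := ℝ) n]

lemma etaSeries_zero {z : ℝ} (hz : |z| < 1) : etaSeries 0 z = (1 + z)⁻¹ := by
  have h : ∀ n : ℕ, (-1 : ℝ) ^ n * (1 / ((n : ℝ) + 1) ^ 0) * z ^ n = (-z) ^ n := by
    intro n
    rw [pow_zero, div_one, mul_one, ← mul_pow]
    ring
  simp only [etaSeries, h]
  rw [tsum_geometric_of_abs_lt_one (by rwa [abs_neg]), sub_neg_eq_add]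

lemma hasDerivAt_mul_etaSeries (k : ℕ) {z : ℝ} (hz : |z| < 1) :
    HasDerivAt (fun z => z * etaSeries (k + 1) z) (etaSeries k z) z := by
  obtain ⟨D, hD, hs⟩ := (polyBounded_eta (k + 1)).hasDerivAt hz
  refine ((hasDerivAt_id z).mul hD).congr_deriv ?_
  have h1 := ((polyBounded_eta (k + 1)).summable hz).hasSum.add hs
  have h2 : HasSum (fun n : ℕ => (-1) ^ n * (1 / ((n : ℝ) + 1) ^ k) * z ^ n) (etaSeries k z) :=
    ((polyBounded_eta k).summable hz).hasSum
  simp only [id, one_mul]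
  refine h1.unique ?_
  convert h2 using 2 with n
  rw [pow_succ]
  field_simp
  ring

/-- The polylogarithms `-Li_k(-u)` at `u = (1 - t) / (1 + t)`. -/
def etaGen (k : ℕ) (t : ℝ) : ℝ := cayley t * etaSeries k (cayley t)

lemma abs_cayley_lt_one {t : ℝ} (ht : t ∈ Set.Ioo (0 : ℝ) 1) : |cayley t| < 1 := by
  rw [abs_of_pos (cayley_mem ht).1]; exact (cayley_mem ht).2

lemma etaGen_zero {t : ℝ} (ht : t ∈ Set.Ioo (0 : ℝ) 1) : etaGen 0 t = (1 - t) / 2 := by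
  have h : 1 + t ≠ 0 := by linarith [ht.1]
  have h' : 1 + t + (1 - t) ≠ 0 := by ring_nf; norm_num
  rw [etaGen, etaSeries_zero (abs_cayley_lt_one ht), cayley]
  field_simp
  ring

lemma hasDerivAt_etaGen_zero {t : ℝ} (ht : t ∈ Set.Ioo (0 : ℝ) 1) :
    HasDerivAt (etaGen 0) (-1 / 2) t := by
  have h : HasDerivAt (fun t : ℝ => (1 - t) / 2) (-1 / 2) t :=
    ((hasDerivAt_id t).const_sub 1).div_const 2
  refine h.congr_of_eventuallyEq ?_
  filter_upwards [isOpen_Ioo.mem_nhds ht] with u hu using etaGen_zero hu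

lemma hasDerivAt_etaGen_succ (k : ℕ) {t : ℝ} (ht : t ∈ Set.Ioo (0 : ℝ) 1) :
    HasDerivAt (etaGen (k + 1)) (-(2 / (1 - t ^ 2)) * etaGen k t) t := by
  have h := HasDerivAt.comp t (hasDerivAt_mul_etaSeries k (abs_cayley_lt_one ht))
    (hasDerivAt_cayley ht)
  refine h.congr_deriv ?_
  have := (cayley_mem ht).1.ne'
  rw [← cayley_logDeriv ht, etaGen]
  field_simp

lemma tendsto_etaGen {k : ℕ} : Tendsto (etaGen k) (𝓝[>] 0) (𝓝 (zetaBar k)) := by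
  rcases Nat.eq_zero_or_pos k with rfl | hk
  · have h : Tendsto (fun t : ℝ => (1 - t) / 2) (𝓝[>] 0) (𝓝 ((1 - 0) / 2)) :=
      ((tendsto_id.const_sub 1).div_const 2).mono_left nhdsWithin_le_nhds
    -- The convention ζ̄(0) = 1/2 is the Abel value of 1 - 1 + 1 - ⋯.
    rw [zetaBar, if_pos rfl]
    rw [sub_zero] at h
    refine h.congr' ?_
    filter_upwards [Ioo_mem_nhdsGT (zero_lt_one' ℝ)] with t ht using (etaGen_zero ht).symm
  · have h1 : Tendsto (etaSeries k) (𝓝[<] 1) (𝓝 (zetaBar k)) :=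
      Real.tendsto_tsum_powerSeries_nhdsWithin_lt
        ((tendsto_zetaBarTrunc hk).congr fun N => zetaBarTrunc_eq k N)
    have h2 := (tendsto_cayley_zero.mono_right nhdsWithin_le_nhds).mul (h1.comp tendsto_cayley_zero)
    rw [one_mul] at h2
    exact h2

lemma tendsto_logRatio_pow_mul_etaGen (i k : ℕ) :
    Tendsto (fun t => logRatio t ^ i * etaGen k t) (𝓝[<] 1) (𝓝 0) := by
  have h1 : ContinuousAt (etaSeries k) 0 :=
    ((polyBounded_eta k).hasDerivAt (z := 0) (by simp)).choose_spec.1.continuousAt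
  have h3 := (tendsto_logRatio_pow_mul_cayley i).mul
    (h1.tendsto.comp (tendsto_cayley_one.mono_right nhdsWithin_le_nhds))
  rw [zero_mul] at h3
  refine h3.congr fun t => ?_
  simp only [Function.comp_apply, etaGen]
  ring

/-- Same telescoping with polylogarithms; the base case `etaGen 0` = (1 - t)/2 has derivative -1/2,
whence the factor 2. -/
lemma integral_logRatio_pow (D : ℕ) :
    ∫ t in (0 : ℝ)..1, logRatio t ^ D / (D.factorial : ℝ) = 2 * zetaBar D := by
  have hd : ∀ t ∈ Set.Ioo (0 : ℝ) 1, HasDerivAt (divSum logRatio etaGen D)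
      (-1 / 2 * (logRatio t ^ D / (D.factorial : ℝ))) t := by
    intro t ht
    refine (hasDerivAt_divSum (X := fun i => if i = 0 then -1 / 2 else 0)
      (hasDerivAt_logRatio ht) (by simpa using hasDerivAt_etaGen_zero ht) (fun j => ?_)
      D).congr_deriv ?_
    · simpa using hasDerivAt_etaGen_succ j ht
    · rw [Finset.sum_range_succ, Finset.sum_eq_zero, zero_add, Nat.sub_self, if_pos rfl, mul_comm]
      intro j hj
      rw [Finset.mem_range] at hj
      rw [if_neg (by omega), mul_zero]
  have h := intervalIntegral.integral_eq_sub_of_hasDerivAt_of_tendsto zero_lt_one hd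
    ((intervalIntegrable_logRatio_pow D).const_mul _)
    (tendsto_divSum tendsto_logRatio_zero (fun k => tendsto_etaGen) D)
    (tendsto_divSum_zero tendsto_logRatio_pow_mul_etaGen D)
  rw [intervalIntegral.integral_const_mul] at h
  linarith

/-! ### Moments of powers of the logarithm -/

/-- `∫₀¹ t ^ k log ((1 + t) / (1 - t)) ^ d / d! dt`. -/
def logMoment (k d : ℕ) : ℝ := ∫ t in (0 : ℝ)..1, t ^ k * (logRatio t ^ d / (d.factorial : ℝ))

lemma intervalIntegrable_moment (k d : ℕ) :
    IntervalIntegrable (fun t : ℝ => t ^ k * (logRatio t ^ d / (d.factorial : ℝ)))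
      MeasureTheory.volume 0 1 :=
  (intervalIntegrable_logRatio_pow d).continuousOn_mul (by fun_prop)

lemma logMoment_zero_right (k : ℕ) : logMoment k 0 = 1 / ((k : ℝ) + 1) := by
  simp [logMoment, integral_pow]

lemma logMoment_zero_left (d : ℕ) : logMoment 0 d = 2 * zetaBar d := by
  rw [logMoment, ← integral_logRatio_pow]
  simp

lemma tendsto_logRatio_pow_mul_sub (d : ℕ) :
    Tendsto (fun t => (1 - t) * logRatio t ^ d) (𝓝[<] 1) (𝓝 0) := by
  have h1 : Tendsto (fun t : ℝ => 1 + t) (𝓝[<] 1) (𝓝 (1 + 1)) :=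
    (tendsto_id.const_add 1).mono_left nhdsWithin_le_nhds
  have h2 := (tendsto_logRatio_pow_mul_cayley d).mul h1
  rw [zero_mul] at h2
  refine h2.congr' ?_
  filter_upwards [Ioo_mem_nhdsLT (zero_lt_one' ℝ)] with t ht
  have : 1 + t ≠ 0 := by linarith [ht.1]
  rw [cayley]
  field_simp

/-- The factor 1 - t² in t^k - t^(k+2) cancels the denominator of the derivative 2/(1 - t²) of
`logRatio` and kills the boundary term at 1; at 0 the logarithm vanishes. For k = 0 the truncated
exponent k - 1 is harmless, being multiplied by k. -/
lemma logMoment_recursion (k d : ℕ) :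
    ((k : ℝ) + 2) * logMoment (k + 1) (d + 1)
      = k * logMoment (k - 1) (d + 1) + 2 * logMoment k d := by
  have hd : ∀ t ∈ Set.Ioo (0 : ℝ) 1, HasDerivAt
      (fun t => (t ^ k - t ^ (k + 2)) * (logRatio t ^ (d + 1) / ((d + 1).factorial : ℝ)))
      (k * (t ^ (k - 1) * (logRatio t ^ (d + 1) / ((d + 1).factorial : ℝ)))
        - ((k : ℝ) + 2) * (t ^ (k + 1) * (logRatio t ^ (d + 1) / ((d + 1).factorial : ℝ)))
        + 2 * (t ^ k * (logRatio t ^ d / (d.factorial : ℝ)))) t := by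
    intro t ht
    refine (((hasDerivAt_pow k t).sub (hasDerivAt_pow (k + 2) t)).mul
      (hasDerivAt_divPow (hasDerivAt_logRatio ht) d)).congr_deriv ?_
    have h4 : 1 - t ^ 2 ≠ 0 := by nlinarith [ht.1, ht.2]
    have h5 : (t ^ k - t ^ (k + 2)) * (2 / (1 - t ^ 2) * (logRatio t ^ d / (d.factorial : ℝ)))
        = 2 * (t ^ k * (logRatio t ^ d / (d.factorial : ℝ))) := by
      rw [show t ^ k - t ^ (k + 2) = t ^ k * (1 - t ^ 2) by ring]
      field_simp
    simp only [Pi.sub_apply]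
    rw [h5, show k + 2 - 1 = k + 1 by omega]
    push_cast
    ring
  have hi1 := (intervalIntegrable_moment (k - 1) (d + 1)).const_mul (k : ℝ)
  have hi2 := (intervalIntegrable_moment (k + 1) (d + 1)).const_mul ((k : ℝ) + 2)
  have hi3 := (intervalIntegrable_moment k d).const_mul 2
  have h0 : Tendsto
      (fun t => (t ^ k - t ^ (k + 2)) * (logRatio t ^ (d + 1) / ((d + 1).factorial : ℝ)))
      (𝓝[>] 0) (𝓝 0) := by
    have h1 : Tendsto (fun t : ℝ => t ^ k - t ^ (k + 2)) (𝓝[>] 0) (𝓝 (0 ^ k - 0 ^ (k + 2))) :=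
      (((continuous_pow k).sub (continuous_pow (k + 2))).tendsto 0).mono_left nhdsWithin_le_nhds
    simpa using h1.mul ((tendsto_logRatio_zero.pow (d + 1)).div_const ((d + 1).factorial : ℝ))
  have h1 : Tendsto
      (fun t => (t ^ k - t ^ (k + 2)) * (logRatio t ^ (d + 1) / ((d + 1).factorial : ℝ)))
      (𝓝[<] 1) (𝓝 0) := by
    have h1 : Tendsto (fun t : ℝ => t ^ k * (1 + t)) (𝓝[<] 1) (𝓝 (1 ^ k * (1 + 1))) :=
      (((continuous_pow k).mul (continuous_const.add continuous_id)).tendsto 1).mono_left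
        nhdsWithin_le_nhds
    have h2 := (h1.mul (tendsto_logRatio_pow_mul_sub (d + 1))).div_const ((d + 1).factorial : ℝ)
    rw [mul_zero, zero_div] at h2
    refine h2.congr fun t => ?_
    ring
  have h := intervalIntegral.integral_eq_sub_of_hasDerivAt_of_tendsto zero_lt_one hd
    ((hi1.sub hi2).add hi3) h0 h1
  rw [intervalIntegral.integral_add (hi1.sub hi2) hi3, intervalIntegral.integral_sub hi1 hi2,
    intervalIntegral.integral_const_mul, intervalIntegral.integral_const_mul,
    intervalIntegral.integral_const_mul] at h
  simp only [logMoment]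
  linarith

/-! ### Recurrences for `T`-harmonic sums and their relation to the moments -/

lemma tHarm_ones_odd_succ (i n : ℕ) :
    tHarm (ones (2 * i + 1)) (n + 2) = tHarm (ones (2 * i + 1)) (n + 1)
      + 2 / (2 * (n : ℝ) + 3) * tHarm (ones (2 * i)) (n + 2) := by
  simp only [tHarm_ones_succ, if_pos (even_two_mul i)]
  rw [Finset.sum_Icc_succ_top (by omega)]
  congr 1
  push_cast
  rw [div_mul_eq_mul_div]
  congr 1
  ring

lemma tHarm_ones_odd_one (i : ℕ) :
    tHarm (ones (2 * i + 1)) 1 = 2 * tHarm (ones (2 * i)) 1 := by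
  rw [tHarm_ones_succ, if_pos (even_two_mul i), Finset.Icc_self, Finset.sum_singleton,
    if_pos (even_two_mul i)]
  norm_num

lemma tHarm_ones_even_succ (i n : ℕ) :
    tHarm (ones (2 * (i + 1))) (n + 2) = tHarm (ones (2 * (i + 1))) (n + 1)
      + 2 / (2 * (n : ℝ) + 2) * tHarm (ones (2 * i + 1)) (n + 1) := by
  have hodd : ¬ Even (2 * i + 1) := by simp
  rw [show 2 * (i + 1) = 2 * i + 1 + 1 by ring]
  simp only [tHarm_ones_succ (2 * i + 1), if_neg hodd]
  rw [show n + 2 - 1 = n + 1 by omega, Nat.add_sub_cancel, Finset.sum_Icc_succ_top (by omega)]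
  congr 1
  push_cast
  rw [div_mul_eq_mul_div]
  congr 1
  ring

lemma tHarm_ones_even_one (i : ℕ) : tHarm (ones (2 * (i + 1))) 1 = 0 :=
  (tHarm_ones_even (i + 1)).1 1 le_rfl (by omega)

/-- The odd and even moments of the powers of the logarithm in terms of `T`-harmonic sums. -/
lemma logMoment_eq_sum (n : ℕ) :
    (∀ b, (2 * (n : ℝ) + 1) * logMoment (2 * n) (2 * b)
      = ∑ i ∈ Finset.range (b + 1), logMoment 0 (2 * (b - i)) * tHarm (ones (2 * i)) (n + 1)) ∧
    ∀ b, (2 * (n : ℝ) + 2) * logMoment (2 * n + 1) (2 * b + 1)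
      = ∑ i ∈ Finset.range (b + 1),
        logMoment 0 (2 * (b - i)) * tHarm (ones (2 * i + 1)) (n + 1) := by
  induction n with
  | zero =>
    have h1 : ∀ b, logMoment 0 (2 * b)
        = ∑ i ∈ Finset.range (b + 1), logMoment 0 (2 * (b - i)) * tHarm (ones (2 * i)) 1 := by
      intro b
      rw [Finset.sum_range_succ', Finset.sum_eq_zero]
      · rw [show 2 * 0 = 0 from rfl, tHarm_ones_zero]; simp
      · intro i _
        rw [tHarm_ones_even_one, mul_zero]
    refine ⟨fun b => by simpa using h1 b, fun b => ?_⟩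
    have h2 := logMoment_recursion 0 (2 * b)
    simp only [Nat.cast_zero, zero_mul, zero_add, mul_zero] at h2 ⊢
    rw [h2, h1 b, Finset.mul_sum]
    refine Finset.sum_congr rfl fun i _ => ?_
    rw [tHarm_ones_odd_one]
    ring
  | succ n ih =>
    obtain ⟨ih1, ih2⟩ := ih
    have h1 : ∀ b, (2 * ((n + 1 : ℕ) : ℝ) + 1) * logMoment (2 * (n + 1)) (2 * b)
        = ∑ i ∈ Finset.range (b + 1),
          logMoment 0 (2 * (b - i)) * tHarm (ones (2 * i)) (n + 1 + 1) := by
      intro b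
      cases b with
      | zero =>
        have h3 : (2 * ((n + 1 : ℕ) : ℝ) + 1) ≠ 0 := by positivity
        simp only [mul_zero, zero_add, Finset.sum_range_one, Nat.sub_self, logMoment_zero_right]
        push_cast at h3 ⊢
        field_simp
        simpa using (tHarm_ones_zero _).symm
      | succ b =>
        -- The recursion adds twice an odd moment of lower logarithmic power, just as T_{n+2} of
        -- even depth arises from T_{n+1} by adding 2/(2n + 2) times a sum of odd depth. It requires
        -- a positive power of the logarithm, hence the separate case b = 0.
        have h2 := logMoment_recursion (2 * n + 1) (2 * b + 1)
        have h3 := ih1 (b + 1)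
        have h4 := ih2 b
        rw [Finset.sum_range_succ'] at h3 ⊢
        simp only [tHarm_ones_even_succ, mul_add (logMoment _ _), Finset.sum_add_distrib]
        have h5 : ∑ i ∈ Finset.range (b + 1), logMoment 0 (2 * (b + 1 - (i + 1)))
            * (2 / (2 * (n : ℝ) + 2) * tHarm (ones (2 * i + 1)) (n + 1))
            = 2 / (2 * (n : ℝ) + 2) * ∑ i ∈ Finset.range (b + 1),
              logMoment 0 (2 * (b - i)) * tHarm (ones (2 * i + 1)) (n + 1) := by
          rw [Finset.mul_sum]
          refine Finset.sum_congr rfl fun i _ => ?_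
          rw [Nat.add_sub_add_right]
          ring
        have h6 : 2 / (2 * (n : ℝ) + 2) * ((2 * (n : ℝ) + 2) * logMoment (2 * n + 1) (2 * b + 1))
            = 2 * logMoment (2 * n + 1) (2 * b + 1) := by
          field_simp
        have h7 : tHarm (ones (2 * 0)) (n + 1 + 1) = tHarm (ones (2 * 0)) (n + 1) := by
          rw [show 2 * 0 = 0 from rfl, tHarm_ones_zero, tHarm_ones_zero]
        rw [h5, ← h4, h6, h7]
        rw [show 2 * (b + 1) = 2 * b + 1 + 1 by ring] at h3 ⊢
        rw [Nat.add_sub_cancel] at h2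
        rw [show 2 * (n + 1) = 2 * n + 1 + 1 by ring]
        rw [Nat.cast_add, Nat.cast_one]
        push_cast at h2
        linarith
    refine ⟨h1, fun b => ?_⟩
    have h2 := logMoment_recursion (2 * n + 2) (2 * b)
    have h3 := ih2 b
    have h4 := h1 b
    simp only [tHarm_ones_odd_succ, mul_add (logMoment _ _), Finset.sum_add_distrib]
    have h5 : ∑ i ∈ Finset.range (b + 1), logMoment 0 (2 * (b - i))
        * (2 / (2 * (n : ℝ) + 3) * tHarm (ones (2 * i)) (n + 2))
        = 2 / (2 * (n : ℝ) + 3) * ∑ i ∈ Finset.range (b + 1),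
          logMoment 0 (2 * (b - i)) * tHarm (ones (2 * i)) (n + 2) := by
      rw [Finset.mul_sum]
      exact Finset.sum_congr rfl fun i _ => by ring
    have h6 : 2 / (2 * (n : ℝ) + 3) * ((2 * ((n + 1 : ℕ) : ℝ) + 1) * logMoment (2 * (n + 1)) (2 * b))
        = 2 * logMoment (2 * n + 2) (2 * b) := by
      have : (2 * (n : ℝ) + 3) ≠ 0 := by positivity
      rw [show 2 * (n + 1) = 2 * n + 2 by ring]
      push_cast
      field_simp
      ring
    rw [h5, ← h4, h6, ← h3]
    rw [show 2 * n + 2 - 1 = 2 * n + 1 by omega] at h2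
    rw [show 2 * (n + 1) + 1 = 2 * n + 2 + 1 by ring]
    push_cast at h2 ⊢
    linarith

lemma slowlyVarying_tHarm (r : ℕ) : SlowlyVarying fun n => tHarm (ones r) (n + 1) := by
  induction r with
  | zero => simpa [tHarm_ones_zero] using SlowlyVarying.const 1
  | succ r ih =>
    by_cases hr : Even r
    · convert (ih.const_mul 2).partialSum le_rfl using 2 with n
      rw [tHarm_ones_succ, if_pos hr, sum_Icc_eq_sum_range]
      refine Finset.sum_congr rfl fun l _ => ?_
      rw [if_pos hr]
      congr 1
      push_cast
      ring
    · have h2 := ih.const_mul 2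
      -- For odd r the new variable is strictly below the bound, so the last summand of the full
      -- partial sum is subtracted.
      convert (h2.partialSum one_le_two).add
        ((h2.mul (SlowlyVarying.inv_linear one_le_two)).const_mul (-1)) using 2 with n
      rw [tHarm_ones_succ, if_neg hr, sum_Icc_eq_sum_range, Nat.add_sub_cancel,
        Finset.sum_range_succ]
      have h3 : ∀ l : ℕ, 2 * tHarm (ones r) (l + 1) /
          (if Even r then 2 * ((l + 1 : ℕ) : ℝ) - 1 else 2 * ((l + 1 : ℕ) : ℝ))
          = 2 * tHarm (ones r) (l + 1) / (2 + 2 * (l : ℝ)) := by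
        intro l
        rw [if_neg hr]
        congr 1
        push_cast
        ring
      simp only [h3]
      ring

/-! ### The series with two `T`-harmonic sums -/

lemma hasSum_of_forall_eq {f g : ℕ → ℝ} {x : ℝ} (h : HasSum g x) (hfg : ∀ n, f n = g n) :
    HasSum f x := by
  rwa [funext hfg]

/-- The power series `∑ (-1) ^ n T_{n + 1}({1}_{2a}) z ^ n`. -/
def harmSeries (a : ℕ) (z : ℝ) : ℝ := ∑' n, (-1) ^ n * tHarm (ones (2 * a)) (n + 1) * z ^ n

lemma polyBounded_tHarm (r : ℕ) : PolyBounded fun n => (-1) ^ n * tHarm (ones r) (n + 1) :=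
  (slowlyVarying_tHarm r).polyBounded.alternate

lemma harmSeries_eq_sumSeries (a : ℕ) {z : ℝ} (hz : |z| < 1) :
    harmSeries a z = (-z) ^ a * sumSeries (2 * a) 0 z := by
  have h1 := ((polyBounded_tHarm (2 * a)).summable hz).hasSum
  have h2 := (hasSum_nat_add_iff' a).2 h1
  have h3 : ∑ n ∈ Finset.range a, (-1) ^ n * tHarm (ones (2 * a)) (n + 1) * z ^ n = 0 := by
    refine Finset.sum_eq_zero fun n hn => ?_
    rw [Finset.mem_range] at hn
    rw [(tHarm_ones_even a).1 (n + 1) (by omega) (by omega)]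
    ring
  rw [h3, sub_zero] at h2
  refine h2.unique ?_
  refine hasSum_of_forall_eq ((hasSum_sumSeries (2 * a) 0 hz).mul_left ((-z) ^ a)) fun n => ?_
  rw [show n + a + 1 = a + 1 + n by ring, (tHarm_ones_even a).2, pow_add, pow_add, neg_pow z]
  ring

/-- The shift by a in `harmSeries_eq_sumSeries` supplies exactly the power u^(2a) of `chainGen`, and
dividing by 1 + u² accounts for the partial sums. -/
lemma harmSeries_sq (a : ℕ) {u : ℝ} (hu : |u| < 1) :
    harmSeries a (u ^ 2)
      = (-1) ^ a / 2 * ((2 * Real.arctan u) ^ (2 * a) / ((2 * a).factorial : ℝ)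
        * (2 / (1 + u ^ 2))) := by
  have hz := sq_abs_lt_one hu
  have h := one_add_mul_sumSeries (2 * a) 0 hz
  have h4 : 1 + u ^ 2 ≠ 0 := by positivity
  rw [harmSeries_eq_sumSeries a hz, ← chainGen_eq_arctan _ hu, chainGen, ← h, neg_pow, ← pow_mul]
  field_simp

/-- The factor ρ^n with ρ < 1 makes the coefficients absolutely summable, so that sum and integral
may be exchanged; ρ → 1 is taken afterwards. -/
lemma intervalIntegral_hasSum_harmSeries (a b : ℕ) {ρ : ℝ} (h0 : 0 ≤ ρ) (h1 : ρ < 1) :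
    HasSum (fun n => (-1) ^ n * tHarm (ones (2 * a)) (n + 1) * logMoment (2 * n) (2 * b) * ρ ^ n)
      (∫ t in (0 : ℝ)..1, harmSeries a (ρ * t ^ 2)
        * (logRatio t ^ (2 * b) / ((2 * b).factorial : ℝ))) := by
  have hρ : |ρ| < 1 := by rwa [abs_of_nonneg h0]
  set c : ℕ → ℝ := fun n => (-1) ^ n * tHarm (ones (2 * a)) (n + 1) with hc
  have hmain := intervalIntegral.hasSum_integral_of_dominated_convergence
    (a := 0) (b := 1) (μ := MeasureTheory.volume)
    (F := fun (n : ℕ) (t : ℝ) =>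
      c n * ρ ^ n * (t ^ (2 * n) * (logRatio t ^ (2 * b) / ((2 * b).factorial : ℝ))))
    (f := fun t => harmSeries a (ρ * t ^ 2) * (logRatio t ^ (2 * b) / ((2 * b).factorial : ℝ)))
    (fun n t => |c n * ρ ^ n| * (logRatio t ^ (2 * b) / ((2 * b).factorial : ℝ))) ?_ ?_ ?_ ?_ ?_
  · refine hasSum_of_forall_eq hmain fun n => ?_
    rw [intervalIntegral.integral_const_mul, logMoment]
    ring
  · intro n
    have := measurable_logRatio
    exact Measurable.aestronglyMeasurable (by fun_prop)
  · intro n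
    refine ae_mem_Ioo_of_uIoc fun t ht => ?_
    have h3 := logRatio_nonneg ht
    rw [Real.norm_eq_abs, abs_mul]
    refine mul_le_mul_of_nonneg_left ?_ (abs_nonneg _)
    have ht0 := ht.1.le
    rw [abs_of_nonneg (by positivity)]
    exact mul_le_of_le_one_left (by positivity) (pow_le_one₀ ht.1.le ht.2.le)
  · exact Eventually.of_forall fun t _ =>
      ((polyBounded_tHarm (2 * a)).summable_abs hρ).mul_right _
  · simp only [tsum_mul_right]
    exact (intervalIntegrable_logRatio_pow _).const_mul _
  · refine ae_mem_Ioo_of_uIoc fun t ht => ?_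
    have h4 : |ρ * t ^ 2| < 1 := by
      rw [abs_mul, abs_of_nonneg h0, abs_of_nonneg (sq_nonneg t)]
      have : t ^ 2 ≤ 1 := pow_le_one₀ ht.1.le ht.2.le
      nlinarith [sq_nonneg t]
    have h5 := (((polyBounded_tHarm (2 * a)).summable h4).hasSum).mul_right
      (logRatio t ^ (2 * b) / ((2 * b).factorial : ℝ))
    refine hasSum_of_forall_eq h5 fun n => ?_
    rw [mul_pow, ← pow_mul]
    ring

/-- With u = √ρ t the series is the closed kernel in arctan u, bounded uniformly in ρ; dominated
convergence applies with a multiple of the divided power of `logRatio`. -/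
lemma tendsto_integral_harmSeries (a b : ℕ) :
    Tendsto (fun ρ => ∫ t in (0 : ℝ)..1, harmSeries a (ρ * t ^ 2)
        * (logRatio t ^ (2 * b) / ((2 * b).factorial : ℝ))) (𝓝[<] 1)
      (𝓝 ((-1) ^ a / 2 * ∫ t in (0 : ℝ)..1, (2 * Real.arctan t) ^ (2 * a) / ((2 * a).factorial : ℝ)
        * (2 / (1 + t ^ 2)) * (logRatio t ^ (2 * b) / ((2 * b).factorial : ℝ)))) := by
  set K : ℝ → ℝ := fun u => (2 * Real.arctan u) ^ (2 * a) / ((2 * a).factorial : ℝ)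
    * (2 / (1 + u ^ 2)) with hK
  have hKc : Continuous K := by
    have : ∀ u : ℝ, 1 + u ^ 2 ≠ 0 := fun u => by positivity
    fun_prop (disch := simpa using this)
  have hmem : ∀ᶠ ρ : ℝ in 𝓝[<] 1, ρ ∈ Set.Ioo (0 : ℝ) 1 := Ioo_mem_nhdsLT zero_lt_one
  have hsub : ∀ ρ ∈ Set.Ioo (0 : ℝ) 1, ∀ t ∈ Set.Ioo (0 : ℝ) 1,
      0 ≤ √ρ * t ∧ √ρ * t < 1 ∧ harmSeries a (ρ * t ^ 2) = (-1) ^ a / 2 * K (√ρ * t) := by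
    intro ρ hρ t ht
    have h1 : √ρ < 1 := (Real.sqrt_lt' one_pos).2 (by simpa using hρ.2)
    have h2 : 0 ≤ √ρ * t := mul_nonneg (Real.sqrt_nonneg _) ht.1.le
    have h3 : √ρ * t < 1 := by nlinarith [ht.1, ht.2, Real.sqrt_nonneg ρ]
    refine ⟨h2, h3, ?_⟩
    rw [← harmSeries_sq a (by rwa [abs_of_nonneg h2]), mul_pow, Real.sq_sqrt hρ.1.le]
  rw [← intervalIntegral.integral_const_mul]
  have hcongr : ∀ᶠ ρ : ℝ in 𝓝[<] 1, ∫ t in (0 : ℝ)..1, (-1) ^ a / 2 * (K (√ρ * t)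
      * (logRatio t ^ (2 * b) / ((2 * b).factorial : ℝ)))
      = ∫ t in (0 : ℝ)..1, harmSeries a (ρ * t ^ 2)
        * (logRatio t ^ (2 * b) / ((2 * b).factorial : ℝ)) := by
    filter_upwards [hmem] with ρ hρ
    refine intervalIntegral.integral_congr_ae (ae_mem_Ioo_of_uIoc fun t ht => ?_)
    rw [(hsub ρ hρ t ht).2.2]
    ring
  refine Tendsto.congr' hcongr ?_
  refine intervalIntegral.tendsto_integral_filter_of_dominated_convergence
    (fun t => 1 * (2 ^ (2 * a) * 2 * (logRatio t ^ (2 * b) / ((2 * b).factorial : ℝ)))) ?_ ?_ ?_ ?_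
  · refine Eventually.of_forall fun ρ => Measurable.aestronglyMeasurable ?_
    have := measurable_logRatio
    have := hKc.measurable
    fun_prop
  · filter_upwards [hmem] with ρ hρ
    refine ae_mem_Ioo_of_uIoc fun t ht => ?_
    obtain ⟨h1, h2, -⟩ := hsub ρ hρ t ht
    have h3 := logRatio_nonneg ht
    rw [Real.norm_eq_abs, abs_mul, abs_mul,
      abs_of_nonneg (a := logRatio t ^ (2 * b) / ((2 * b).factorial : ℝ)) (by positivity)]
    have h4 : |(-1 : ℝ) ^ a / 2| ≤ 1 := by
      rw [abs_div, abs_pow, abs_neg, abs_one, one_pow, abs_two]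
      norm_num
    refine mul_le_mul h4 (mul_le_mul_of_nonneg_right ?_ (by positivity)) (by positivity)
      zero_le_one
    exact arctan_kernel_bound (2 * a) h1 h2.le
  · exact ((intervalIntegrable_logRatio_pow _).const_mul _).const_mul _
  · refine Eventually.of_forall fun t _ => ?_
    have h1 : ContinuousAt (fun ρ : ℝ => K (√ρ * t)) 1 := by fun_prop
    have h2 : Tendsto (fun ρ : ℝ => K (√ρ * t)) (𝓝[<] 1) (𝓝 (K t)) := by
      simpa using h1.tendsto.mono_left nhdsWithin_le_nhds
    exact (h2.mul_const _).const_mul _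

/-- Convergence at ρ = 1 must be known beforehand for Abel's theorem; it holds because 2n + 1 times
the moment is a combination of slowly varying sums. -/
lemma exists_tendsto_tHarm_mul_logMoment (a b : ℕ) : ∃ L : ℝ, Tendsto
    (fun N => ∑ n ∈ Finset.range N,
      (-1) ^ n * tHarm (ones (2 * a)) (n + 1) * logMoment (2 * n) (2 * b)) atTop (𝓝 L) := by
  have hu := (slowlyVarying_tHarm (2 * a)).mul (SlowlyVarying.finset_sum (Finset.range (b + 1))
    fun i _ => (slowlyVarying_tHarm (2 * i)).const_mul (logMoment 0 (2 * (b - i))))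
  obtain ⟨L, hL⟩ := hu.exists_tendsto le_rfl
  refine ⟨L, hL.congr fun N => Finset.sum_congr rfl fun n _ => ?_⟩
  have h : 1 + 2 * (n : ℝ) ≠ 0 := by positivity
  rw [← (logMoment_eq_sum n).1 b]
  field_simp
  ring

lemma tendsto_tHarm_mul_logMoment (a b : ℕ) : Tendsto
    (fun N => ∑ n ∈ Finset.range N,
      (-1) ^ n * tHarm (ones (2 * a)) (n + 1) * logMoment (2 * n) (2 * b)) atTop
    (𝓝 ((-1) ^ a / 2 * -W (2 * a + 1 + 2 * b) (2 * a + 1))) := by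
  obtain ⟨L, hL⟩ := exists_tendsto_tHarm_mul_logMoment a b
  have h1 := Real.tendsto_tsum_powerSeries_nhdsWithin_lt hL
  have h2 := tendsto_integral_harmSeries a b
  rw [integral_arctan_pow_mul_logRatio_pow (tendsto_chainCoeff_W (2 * a) (2 * b))] at h2
  have h3 : L = (-1) ^ a / 2 * ((-1) ^ (2 * a + 1) * W (2 * a + 1 + 2 * b) (2 * a + 1)) := by
    refine tendsto_nhds_unique (h1.congr' ?_) h2
    filter_upwards [Ioo_mem_nhdsLT (zero_lt_one' ℝ)] with ρ hρ
    exact (intervalIntegral_hasSum_harmSeries a b hρ.1.le hρ.2).tsum_eq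
  rw [h3, pow_succ, pow_mul] at hL
  simpa using hL

lemma tendsto_tHarm_mul_logMoment_Icc (m j : ℕ) (hm : 0 < m) (hj : 0 < j) : Tendsto
    (fun N => 2 * ∑ n ∈ Finset.Icc 1 N,
      tHarm (ones (2 * m - 2)) n * logMoment (2 * (n - 1)) (2 * (j - 1)) * (-1 : ℝ) ^ n) atTop
    (𝓝 ((-1) ^ (m - 1) * W (2 * j + 2 * m - 3) (2 * m - 1))) := by
  obtain ⟨a, rfl⟩ : ∃ a, m = a + 1 := ⟨m - 1, by omega⟩
  obtain ⟨b, rfl⟩ : ∃ b, j = b + 1 := ⟨j - 1, by omega⟩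
  have h := (tendsto_tHarm_mul_logMoment a b).const_mul (-2)
  rw [show 2 * (b + 1) + 2 * (a + 1) - 3 = 2 * a + 1 + 2 * b by omega,
    show 2 * (a + 1) - 1 = 2 * a + 1 by omega, show 2 * (a + 1) - 2 = 2 * a by omega,
    Nat.add_sub_cancel, Nat.add_sub_cancel]
  convert h using 2 with N
  · rw [sum_Icc_eq_sum_range, Finset.mul_sum, Finset.mul_sum]
    refine Finset.sum_congr rfl fun n _ => ?_
    rw [Nat.add_sub_cancel, pow_succ]
    ring
  · ring

/-- The leading coefficient M(0, 0) = 1 makes the system unitriangular, the shape required by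
`eq_sum_Z`. -/
lemma logMoment_div_eq_sum {n j : ℕ} (hn : 1 ≤ n) (hj : 1 ≤ j) :
    logMoment (2 * (n - 1)) (2 * (j - 1))
      = tHarm (ones (2 * j - 2)) n / (2 * (n : ℝ) - 1)
        + ∑ q ∈ Finset.Ico 1 j, 2 * zetaBar (2 * j - 2 * q)
          * (tHarm (ones (2 * q - 2)) n / (2 * (n : ℝ) - 1)) := by
  obtain ⟨n, rfl⟩ : ∃ n', n = n' + 1 := ⟨n - 1, by omega⟩
  obtain ⟨b, rfl⟩ : ∃ b', j = b' + 1 := ⟨j - 1, by omega⟩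
  have h := (logMoment_eq_sum n).1 b
  have h0 : 2 * (n : ℝ) + 1 ≠ 0 := by positivity
  have h1 : 2 * ((n + 1 : ℕ) : ℝ) - 1 = 2 * (n : ℝ) + 1 := by push_cast; ring
  have h2 : logMoment 0 (2 * (b - b)) = 1 := by
    rw [Nat.sub_self, mul_zero, logMoment_zero_right]; norm_num
  rw [Finset.sum_range_succ, h2, one_mul] at h
  rw [h1, show 2 * (b + 1) - 2 = 2 * b by omega, Nat.add_sub_cancel, Nat.add_sub_cancel,
    Finset.sum_Ico_eq_sum_range, Nat.add_sub_cancel]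
  have h3 : ∑ k ∈ Finset.range b, 2 * zetaBar (2 * (b + 1) - 2 * (1 + k))
      * (tHarm (ones (2 * (1 + k) - 2)) (n + 1) / (2 * (n : ℝ) + 1))
      = (∑ i ∈ Finset.range b, logMoment 0 (2 * (b - i)) * tHarm (ones (2 * i)) (n + 1))
        / (2 * (n : ℝ) + 1) := by
    rw [Finset.sum_div]
    refine Finset.sum_congr rfl fun i _ => ?_
    rw [logMoment_zero_left, show 2 * (b + 1) - 2 * (1 + i) = 2 * (b - i) by omega,
      show 2 * (1 + i) - 2 = 2 * i by omega]
    ring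
  rw [h3, ← add_div, eq_div_iff h0, add_comm (tHarm _ _), ← h]
  ring

end AltMTV

end

theorem theorem3p3 (m p : ℕ) (hm : 0 < m) (hp : 0 < p) :
    (∀ j ∈ Finset.Icc 1 p, ∀ k ∈ AltMTV.indexSet (2 * j + 2 * m - 3) (2 * m - 1),
      ∃ L : ℝ, Filter.Tendsto (AltMTV.tbarTrunc k) Filter.atTop (nhds L)) ∧
    (∀ i : ℕ, 0 < i →
      ∃ L : ℝ, Filter.Tendsto (AltMTV.zetaBarTrunc (2 * i)) Filter.atTop (nhds L)) ∧
    Filter.Tendsto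
      (fun N : ℕ => 2 * ∑ n ∈ Finset.Icc 1 N,
        AltMTV.tHarm (AltMTV.ones (2 * m - 2)) n * AltMTV.tHarm (AltMTV.ones (2 * p - 2)) n /
          (2 * (n : ℝ) - 1) * (-1 : ℝ) ^ n)
      Filter.atTop
      (nhds ((-1 : ℝ) ^ (m - 1) *
        ∑ j ∈ Finset.Icc 1 p, AltMTV.W (2 * j + 2 * m - 3) (2 * m - 1) * AltMTV.Z j p)) := by
  refine ⟨fun j _ => ?_, fun i hi => AltMTV.exists_tendsto_zetaBarTrunc (by omega), ?_⟩
  · obtain ⟨r, hr⟩ : ∃ r, 2 * m - 1 = r + 1 := ⟨2 * m - 2, by omega⟩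
    rw [hr]
    exact fun k hk => AltMTV.exists_tendsto_tbarTrunc k (AltMTV.mem_indexSet.1 hk).1
  · have hlim := tendsto_finsetSum (Finset.Icc 1 p) fun j hj =>
      (AltMTV.tendsto_tHarm_mul_logMoment_Icc m j hm (Finset.mem_Icc.1 hj).1).mul_const
        (AltMTV.Z j p)
    have hrw : (-1 : ℝ) ^ (m - 1) *
        ∑ j ∈ Finset.Icc 1 p, AltMTV.W (2 * j + 2 * m - 3) (2 * m - 1) * AltMTV.Z j p
        = ∑ j ∈ Finset.Icc 1 p,
          (-1 : ℝ) ^ (m - 1) * AltMTV.W (2 * j + 2 * m - 3) (2 * m - 1) * AltMTV.Z j p := by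
      rw [Finset.mul_sum]
      exact Finset.sum_congr rfl fun j _ => by ring
    rw [hrw]
    refine hlim.congr fun N => ?_
    symm
    -- The inversion is applied to the partial sums at fixed N, so convergence of the left-hand
    -- series follows from that of the moment series.
    refine AltMTV.eq_sum_Z (p := p)
      (X := fun j => 2 * ∑ n ∈ Finset.Icc 1 N,
        AltMTV.tHarm (AltMTV.ones (2 * m - 2)) n * AltMTV.tHarm (AltMTV.ones (2 * j - 2)) n /
          (2 * (n : ℝ) - 1) * (-1 : ℝ) ^ n)
      (Y := fun j => 2 * ∑ n ∈ Finset.Icc 1 N, AltMTV.tHarm (AltMTV.ones (2 * m - 2)) n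
        * AltMTV.logMoment (2 * (n - 1)) (2 * (j - 1)) * (-1 : ℝ) ^ n)
      (fun j hj => ?_) p (Finset.mem_Icc.2 ⟨hp, le_rfl⟩)
    have hterm : ∀ n ∈ Finset.Icc 1 N, 2 * (AltMTV.tHarm (AltMTV.ones (2 * m - 2)) n
        * AltMTV.logMoment (2 * (n - 1)) (2 * (j - 1)) * (-1 : ℝ) ^ n)
        = 2 * (AltMTV.tHarm (AltMTV.ones (2 * m - 2)) n
            * AltMTV.tHarm (AltMTV.ones (2 * j - 2)) n / (2 * (n : ℝ) - 1) * (-1 : ℝ) ^ n)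
          + ∑ q ∈ Finset.Ico 1 j, 2 * AltMTV.zetaBar (2 * j - 2 * q)
            * (2 * (AltMTV.tHarm (AltMTV.ones (2 * m - 2)) n
              * AltMTV.tHarm (AltMTV.ones (2 * q - 2)) n / (2 * (n : ℝ) - 1) * (-1 : ℝ) ^ n)) := by
      intro n hn
      rw [AltMTV.logMoment_div_eq_sum (Finset.mem_Icc.1 hn).1 (Finset.mem_Icc.1 hj).1, mul_add,
        add_mul, mul_add, Finset.mul_sum, Finset.sum_mul, Finset.mul_sum]
      congr 1
      · ring
      · exact Finset.sum_congr rfl fun q _ => by ring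
    simp only [Finset.mul_sum]
    rw [Finset.sum_congr rfl hterm, Finset.sum_add_distrib, Finset.sum_comm]
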